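/- Let $k$ be an algebraically closed field of characteristic $p>0$. For $i=1,2$ let $F_i$ be either $k((t))$ or a totally ramified finite extension of $W(k)[1/p]$, with ring of integers $\mathcal O_i$ and uniformizer $\varpi_i$ ($\varpi_i=t$ if $F_i=k((t))$), and let $v_{F_i}$ be the normalized valuation. For a perfect $k$-algebra $R$ let $\mathcal O_{i,R}$ be $R[[t]]$ if $F_i=k((t))$, and $W(R)\otimes_{W(k)}\mathcal O_i$ otherwise; for $a\in R$ let $[a]\in\mathcal O_{i,R}$ be $a$, respectively the Teichmüller lift of $a$. Let $n,N\ge 0$ be integers. Let $\mathrm{Gr}_{i}$ be the affine Grassmannian of $\mathrm{GL}_n$ over $\mathcal O_i$, i.e. the functor sending a perfect $k$-algebra $R$ to the set of pairs $(\mathcal E,\beta)$ up to isomorphism, where $\mathcal E$ is a projective $\mathcal O_{i,R}$-module of rank $n$ and $\beta\colon\mathcal E[1/\varpi_i]\cong\mathcal O_{i,R}[1/\varpi_i]^n$; equivalently, of lattices $\mathcal E\subset\mathcal O_{i,R}[1/\varpi_i]^n$. Let $\overline{\mathrm{Gr}}_{i,N}=\mathrm{Gr}_{i,\le(N,0,\dots,0)}\subset\mathrm{Gr}_i$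 be the subspace of those $\mathcal E$ such that at every $x\in\operatorname{Spec}R$ the relative position of $\mathcal E\otimes_{\mathcal O_{i,R}}\mathcal O_{i,\kappa(x)}$ to $\mathcal O_{i,\kappa(x)}^n$ is $\le(N,0,\dots,0)$ in the dominance order. The group $L^+\mathrm{GL}_n(R)=\mathrm{GL}_n(\mathcal O_{i,R})$ acts on it; put $L^N\mathrm{GL}_n(R)=\mathrm{GL}_n(\mathcal O_{i,R}/\varpi_i^N)$. Assume $v_{F_1}(p)\ge N$ and $v_{F_2}(p)\ge N$. Then: 1. For every perfect $k$-algebra $R$, every element of $\mathcal O_{i,R}/\varpi_i^N$ is uniquely of the form $\sum_{j=0}^{N-1}[a_j]\varpi_i^j$ with $a_j\in R$, and $$\theta_R\colon \mathcal O_{1,R}/\varpi_1^N\to\mathcal O_{2,R}/\varpi_2^N,\qquad \sum_{j=0}^{N-1}[a_j]\varpi_1^j\mapsto\sum_{j=0}^{N-1}[a_j]\varpi_2^j,$$ is a ring isomorphism, natural in $R$. 2. There is a unique isomorphism $\alpha\colon\overline{\mathrm{Gr}}_{1,N}\cong\overline{\mathrm{Gr}}_{2,N}$ of functors on perfect $k$-algebras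 that comes from $\theta$ in the following sense: for every point $\mathcal E\in\overline{\mathrm{Gr}}_{1,N}(R)$ one has $\varpi_1^N\mathcal O_{1,R}^n\subset\mathcal E\subset\mathcal O_{1,R}^n$ and $\varpi_2^N\mathcal O_{2,R}^n\subset\alpha(\mathcal E)\subset\mathcal O_{2,R}^n$, and $\theta_R$ carries $\mathcal E/\varpi_1^N\mathcal O_{1,R}^n$ onto $\alpha(\mathcal E)/\varpi_2^N\mathcal O_{2,R}^n$. 3. For $i=1,2$ the map $L^+\mathrm{GL}_n(R)\to L^N\mathrm{GL}_n(R)$ is surjective for every perfect $R$, and the action of $L^+\mathrm{GL}_n$ on $\overline{\mathrm{Gr}}_{i,N}$ factors through $L^N\mathrm{GL}_n$. The isomorphism $\alpha$ is equivariant for these actions of $L^N\mathrm{GL}_n$, through the isomorphism $\mathrm{GL}_n(\mathcal O_{1,R}/\varpi_1^N)\cong\mathrm{GL}_n(\mathcal O_{2,R}/\varpi_2^N)$ induced by $\theta_R$. -/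

import Mathlib

open CategoryTheory TensorProduct
open scoped nonZeroDivisors

universe u

noncomputable section

namespace AffGr

/-! ### Lattices in `A[1/ϖ]ⁿ` -/

section Lattice

variable {A B C : Type u} [CommRing A] [CommRing B] [CommRing C]

/-- The module `A[1/ϖ]ⁿ`. -/
abbrev Amb (ϖ : A) (n : ℕ) : Type u := Fin n → Localization.Away ϖ

/-- The canonical map `Aⁿ → A[1/ϖ]ⁿ`. -/
def std (ϖ : A) (n : ℕ) : (Fin n → A) →ₗ[A] Amb ϖ n :=
  (Algebra.linearMap A (Localization.Away ϖ)).compLeft (Fin n)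

/-- `ϖ` as a unit of `A[1/ϖ]`. -/
def unifUnit (ϖ : A) : (Localization.Away ϖ)ˣ :=
  (IsLocalization.Away.algebraMap_isUnit (S := Localization.Away ϖ) ϖ).unit

/-- An `A`-lattice: a projective `A`-submodule `E ⊆ A[1/ϖ]ⁿ` of rank `n` which generates `A[1/ϖ]ⁿ`
over `A[1/ϖ]`. For a nonzerodivisor `ϖ`, these are the isomorphism classes of pairs `(E, β)` of
a projective `A`-module `E` of rank `n` and an isomorphism `β : E[1/ϖ] ≃ A[1/ϖ]ⁿ`:
the lattice attached to `(E, β)` is `β(E)`. -/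
structure IsLattice (ϖ : A) (n : ℕ) (E : Submodule A (Amb ϖ n)) : Prop where
  finite : Module.Finite A E
  projective : Module.Projective A E
  rank : ∀ P : PrimeSpectrum A, Module.rankAtStalk E P = n
  span_eq_top : Submodule.span (Localization.Away ϖ) (E : Set (Amb ϖ n)) = ⊤

/-- The map `A[1/ϖ] → B[1/ϖ']` induced by a ring homomorphism `f` with `f ϖ = ϖ'`. -/
def locMap {ϖ : A} {ϖ' : B} (f : A →+* B) (hf : f ϖ = ϖ') :
    Localization.Away ϖ →+* Localization.Away ϖ' :=
  IsLocalization.Away.lift ϖ (g := (algebraMap B (Localization.Away ϖ')).comp f)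
    (by simpa [hf] using IsLocalization.Away.algebraMap_isUnit (S := Localization.Away ϖ') ϖ')

/-- The base change of `E ⊆ A[1/ϖ]ⁿ` along `f : A → B`: the `B`-submodule of `B[1/ϖ']ⁿ` generated by
the image of `E` (for lattices this is `E ⊗_A B`). -/
def baseChange {ϖ : A} {ϖ' : B} {n : ℕ} (f : A →+* B) (hf : f ϖ = ϖ')
    (E : Submodule A (Amb ϖ n)) : Submodule B (Amb ϖ' n) :=
  Submodule.span B ((fun v i => locMap f hf (v i)) '' (E : Set (Amb ϖ n)))

/-- `E ⊆ A[1/ϖ]ⁿ` has relative position `m` to `E₀ = Aⁿ`: `m` is nonincreasing, and there is a basis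
`f₁, …, fₙ` of `Aⁿ` such that the vectors `eᵢ = ϖ ^ mᵢ fᵢ` generate `E` (they are
then a basis of `E` if `A` is a domain and `ϖ ≠ 0`). -/
def HasRelPos (ϖ : A) {n : ℕ} (E : Submodule A (Amb ϖ n)) (m : Fin n → ℤ) : Prop :=
  Antitone m ∧ ∃ f : Module.Basis (Fin n) A (Fin n → A),
    E = Submodule.span A (Set.range fun i =>
      ((unifUnit ϖ ^ m i : (Localization.Away ϖ)ˣ) : Localization.Away ϖ) • std ϖ n (f i))

/-- The image of `E` under `g ∈ GLₙ(A)`, acting on `A[1/ϖ]ⁿ`. -/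
def glAct {ϖ : A} {n : ℕ} (g : GL (Fin n) A) (E : Submodule A (Amb ϖ n)) :
    Submodule A (Amb ϖ n) :=
  E.map ((Matrix.mulVecLin ((g : Matrix (Fin n) (Fin n) A).map
    (algebraMap A (Localization.Away ϖ)))).restrictScalars A)

/-- The reduction of a lattice: the image in `(A/ϖᴺ)ⁿ` of `E ∩ Aⁿ`. If `ϖᴺAⁿ ⊆ E ⊆ Aⁿ` this is
`E/ϖᴺAⁿ`. -/
def reduction {ϖ : A} {n : ℕ} (N : ℕ) (E : Submodule A (Amb ϖ n)) :
    Set (Fin n → A ⧸ Ideal.span {ϖ ^ N}) :=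
  (fun v i => Ideal.Quotient.mk _ (v i)) '' {v : Fin n → A | std ϖ n v ∈ E}

/-- `ϖᴺAⁿ ⊆ E ⊆ Aⁿ`. -/
def IsBetween {ϖ : A} {n : ℕ} (N : ℕ) (E : Submodule A (Amb ϖ n)) : Prop :=
  (∀ v : Fin n → A, ϖ ^ N • std ϖ n v ∈ E) ∧ E ≤ LinearMap.range (std ϖ n)

@[simp] theorem std_apply (ϖ : A) (n : ℕ) (v : Fin n → A) (i : Fin n) :
    std ϖ n v i = algebraMap A _ (v i) := rfl

@[simp] theorem locMap_algebraMap {ϖ : A} {ϖ' : B} (f : A →+* B) (hf : f ϖ = ϖ') (a : A) :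
    locMap f hf (algebraMap A _ a) = algebraMap B _ (f a) := by
  simp [locMap]

theorem locMap_smul {ϖ : A} {ϖ' : B} (f : A →+* B) (hf : f ϖ = ϖ') (a : A)
    (x : Localization.Away ϖ) : locMap f hf (a • x) = f a • locMap f hf x := by
  simp [Algebra.smul_def]

theorem locMap_id {ϖ : A} (f : A →+* A) (hf : f ϖ = ϖ) (h : f = RingHom.id A)
    (x : Localization.Away ϖ) : locMap f hf x = x := by
  subst h
  have : locMap (RingHom.id A) hf = RingHom.id _ := by
    apply IsLocalization.ringHom_ext (Submonoid.powers ϖ)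
    ext; simp
  rw [this]; rfl

theorem locMap_comp {ϖ : A} {ϖ' : B} {ϖ'' : C} (f : A →+* B) (hf : f ϖ = ϖ') (g : B →+* C)
    (hg : g ϖ' = ϖ'') (h : A →+* C) (hh : h ϖ = ϖ'') (e : h = g.comp f)
    (x : Localization.Away ϖ) : locMap h hh x = locMap g hg (locMap f hf x) := by
  subst e
  have : locMap (g.comp f) hh = (locMap g hg).comp (locMap f hf) := by
    apply IsLocalization.ringHom_ext (Submonoid.powers ϖ)
    ext; simp
  rw [this]; rfl

theorem locMap_unifUnit_zpow {ϖ : A} {ϖ' : B} (f : A →+* B) (hf : f ϖ = ϖ') (m : ℤ) :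
    locMap f hf ((unifUnit ϖ ^ m : (Localization.Away ϖ)ˣ) : Localization.Away ϖ) =
      ((unifUnit ϖ' ^ m : (Localization.Away ϖ')ˣ) : Localization.Away ϖ') := by
  have h : Units.map (locMap f hf : Localization.Away ϖ →* Localization.Away ϖ') (unifUnit ϖ) =
      unifUnit ϖ' := by
    ext; simp [unifUnit, hf]
  rw [← h, ← map_zpow]; rfl

/-- The additive and semilinear map underlying `baseChange`. -/
def bcMap {ϖ : A} {ϖ' : B} {n : ℕ} (f : A →+* B) (hf : f ϖ = ϖ') : Amb ϖ n →ₛₗ[f] Amb ϖ' n where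
  toFun v i := locMap f hf (v i)
  map_add' _ _ := by ext; simp
  map_smul' _ _ := by ext; simp [locMap_smul]

theorem baseChange_span {ϖ : A} {ϖ' : B} {n : ℕ} (f : A →+* B) (hf : f ϖ = ϖ')
    (s : Set (Amb ϖ n)) : baseChange f hf (Submodule.span A s) =
      Submodule.span B ((fun v i => locMap f hf (v i)) '' s) := by
  apply le_antisymm
  · refine Submodule.span_le.2 ?_
    rintro _ ⟨v, hv, rfl⟩
    change bcMap f hf v ∈ _
    induction hv using Submodule.span_induction with
    | mem x hx => exact Submodule.subset_span ⟨x, hx, rfl⟩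
    | zero => simp
    | add x y _ _ hx hy => rw [map_add]; exact add_mem hx hy
    | smul a x _ hx => rw [map_smulₛₗ]; exact Submodule.smul_mem _ _ hx
  · exact Submodule.span_mono (Set.image_mono Submodule.subset_span)

theorem baseChange_id {ϖ : A} {n : ℕ} (f : A →+* A) (hf : f ϖ = ϖ) (h : f = RingHom.id A)
    (E : Submodule A (Amb ϖ n)) : baseChange f hf E = E := by
  simp [baseChange, locMap_id f hf h]

theorem baseChange_comp {ϖ : A} {ϖ' : B} {ϖ'' : C} {n : ℕ} (f : A →+* B) (hf : f ϖ = ϖ')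
    (g : B →+* C) (hg : g ϖ' = ϖ'') (h : A →+* C) (hh : h ϖ = ϖ'') (e : h = g.comp f)
    (E : Submodule A (Amb ϖ n)) :
    baseChange h hh E = baseChange g hg (baseChange f hf E) := by
  conv_rhs => rw [baseChange.eq_def f hf, baseChange_span]
  rw [baseChange, Set.image_image]
  simp [locMap_comp f hf g hg h hh e]

theorem HasRelPos.baseChange {ϖ : A} {ϖ' : B} {n : ℕ} (f : A →+* B) (hf : f ϖ = ϖ')
    {E : Submodule A (Amb ϖ n)} {m : Fin n → ℤ} (h : HasRelPos ϖ E m) :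
    HasRelPos ϖ' (AffGr.baseChange f hf E) m := by
  obtain ⟨hm, b, rfl⟩ := h
  let _ := f.toAlgebra
  refine ⟨hm, (b.baseChange B).map (TensorProduct.piScalarRight A B B (Fin n)), ?_⟩
  rw [baseChange_span, ← Set.range_comp]
  congr 2
  ext i j
  simp only [Function.comp, Pi.smul_apply, smul_eq_mul, map_mul, locMap_unifUnit_zpow, std_apply,
    locMap_algebraMap]
  simp [Algebra.smul_def, RingHom.algebraMap_toAlgebra]

theorem std_injective {ϖ : A} (h : ϖ ∈ A⁰) (n : ℕ) : Function.Injective (std ϖ n) := by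
  intro v w e
  ext i
  exact IsLocalization.injective (Localization.Away ϖ)
    (Submonoid.powers_le.2 h) (congrFun e i)

/-- Elements of `A[1/ϖ]ⁿ` have bounded denominators. -/
theorem exists_pow_smul_mem_range {ϖ : A} {n : ℕ} {E : Submodule A (Amb ϖ n)} (hE : E.FG) :
    ∃ k : ℕ, ∀ v ∈ E, ϖ ^ k • v ∈ LinearMap.range (std ϖ n) := by
  obtain ⟨s, rfl⟩ := hE
  have key : ∀ v : Amb ϖ n, ∃ k : ℕ, ϖ ^ k • v ∈ LinearMap.range (std ϖ n) := by
    intro v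
    obtain ⟨⟨_, k, rfl⟩, hb⟩ := IsLocalization.exist_integer_multiples (Submonoid.powers ϖ)
      Finset.univ v
    choose w hw using hb
    refine ⟨k, fun i => w i (Finset.mem_univ i), ?_⟩
    ext i
    exact hw i (Finset.mem_univ i)
  choose k hk using key
  refine ⟨s.sup k, fun v hv => ?_⟩
  induction hv using Submodule.span_induction with
  | mem x hx =>
    have : k x ≤ s.sup k := Finset.le_sup (f := k) hx
    obtain ⟨d, hd⟩ := Nat.exists_eq_add_of_le this
    rw [hd, add_comm, pow_add, mul_smul]
    exact Submodule.smul_mem _ _ (hk x)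
  | zero => simp
  | add x y _ _ hx hy => rw [smul_add]; exact add_mem hx hy
  | smul a x _ hx => rw [smul_comm]; exact Submodule.smul_mem _ _ hx

theorem exists_pow_smul_std_mem {ϖ : A} {n : ℕ} {E : Submodule A (Amb ϖ n)}
    (hE : Submodule.span (Localization.Away ϖ) (E : Set (Amb ϖ n)) = ⊤) :
    ∃ k : ℕ, ∀ v, ϖ ^ k • std ϖ n v ∈ E := by
  have key : ∀ v : Amb ϖ n, ∃ k : ℕ, ϖ ^ k • v ∈ E := by
    intro v
    have hv : v ∈ Submodule.span (Localization.Away ϖ) (E : Set (Amb ϖ n)) := hE ▸ trivial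
    induction hv using Submodule.span_induction with
    | mem x hx => exact ⟨0, by simpa using hx⟩
    | zero => exact ⟨0, by simp⟩
    | add x y _ _ hx hy =>
      obtain ⟨a, ha⟩ := hx
      obtain ⟨b, hb⟩ := hy
      refine ⟨a + b, ?_⟩
      rw [smul_add]
      refine add_mem ?_ ?_
      · rw [add_comm, pow_add, mul_smul]; exact E.smul_mem _ ha
      · rw [pow_add, mul_smul]; exact E.smul_mem _ hb
    | smul a x _ hx =>
      obtain ⟨b, hb⟩ := hx
      obtain ⟨⟨_, k, rfl⟩, c, hc⟩ := IsLocalization.exists_integer_multiple (Submonoid.powers ϖ) a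
      refine ⟨k + b, ?_⟩
      have : ϖ ^ (k + b) • a • x = c • ϖ ^ b • x := by
        rw [← algebraMap_smul (Localization.Away ϖ) c, hc, pow_add, mul_smul, smul_comm (ϖ ^ b) a,
          smul_assoc]
      rw [this]
      exact E.smul_mem _ hb
  choose k hk using key
  refine ⟨Finset.univ.sup fun i => k (std ϖ n (Pi.single i 1)), fun v => ?_⟩
  rw [← Finset.univ_sum_single v, map_sum, Finset.smul_sum]
  refine sum_mem fun i _ => ?_
  have h1 : (Pi.single i (v i) : Fin n → A) = v i • Pi.single i 1 := by
    simp [← Pi.single_smul]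
  rw [h1, map_smul, smul_comm]
  refine E.smul_mem _ ?_
  have : k (std ϖ n (Pi.single i 1)) ≤ Finset.univ.sup fun i => k (std ϖ n (Pi.single i 1)) :=
    Finset.le_sup (f := fun i => k (std ϖ n (Pi.single i 1))) (Finset.mem_univ i)
  obtain ⟨d, hd⟩ := Nat.exists_eq_add_of_le this
  rw [hd, add_comm, pow_add, mul_smul]
  exact Submodule.smul_mem _ _ (hk _)

theorem IsLattice.baseChange {ϖ : A} {ϖ' : B} {n : ℕ} (hϖ : ϖ ∈ A⁰) (hϖ' : ϖ' ∈ B⁰)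
    (f : A →+* B) (hf : f ϖ = ϖ') {E : Submodule A (Amb ϖ n)} (hE : IsLattice ϖ n E) :
    IsLattice ϖ' n (AffGr.baseChange f hf E) := by
  let _ := f.toAlgebra
  have halg : ∀ a : A, algebraMap A B a = f a := fun _ => rfl
  have := hE.finite
  have := hE.projective
  let F : E →ₗ[A] Amb ϖ' n :=
    { toFun := fun v => bcMap f hf v
      map_add' := fun v w => by simp
      map_smul' := fun a v => by
        change bcMap f hf (a • (v : Amb ϖ n)) = a • bcMap f hf (v : Amb ϖ n)
        rw [map_smulₛₗ]
        exact algebraMap_smul B a (bcMap f hf (v : Amb ϖ n)) }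
  let Φ : B ⊗[A] E →ₗ[B] Amb ϖ' n := F.liftBaseChange B
  have hΦ : ∀ b v, Φ (b ⊗ₜ v) = b • bcMap f hf (v : Amb ϖ n) := fun b v =>
    LinearMap.liftBaseChange_tmul ..
  have hrange : LinearMap.range Φ = AffGr.baseChange f hf E := by
    apply le_antisymm
    · rintro _ ⟨z, rfl⟩
      induction z with
      | zero => simp
      | tmul b v =>
        rw [hΦ]
        exact Submodule.smul_mem _ _ (Submodule.subset_span ⟨v, v.2, rfl⟩)
      | add x y hx hy => rw [map_add]; exact add_mem hx hy
    · refine Submodule.span_le.2 ?_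
      rintro _ ⟨v, hv, rfl⟩
      refine ⟨1 ⊗ₜ ⟨v, hv⟩, ?_⟩
      rw [hΦ, one_smul]; rfl
  obtain ⟨k, hk⟩ := exists_pow_smul_mem_range ((Module.Finite.iff_fg).1 hE.finite)
  obtain ⟨l, hl⟩ := exists_pow_smul_std_mem hE.span_eq_top
  let w : E →ₗ[A] (Fin n → A) :=
    (LinearEquiv.ofInjective _ (std_injective hϖ n)).symm.toLinearMap ∘ₗ
      (LinearMap.codRestrict (LinearMap.range (std ϖ n)) (ϖ ^ k • E.subtype) fun v => hk v v.2)
  have hw : ∀ v, std ϖ n (w v) = ϖ ^ k • (v : Amb ϖ n) := fun v =>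
    congrArg Subtype.val ((LinearEquiv.ofInjective _ (std_injective hϖ n)).apply_symm_apply
      ⟨ϖ ^ k • (v : Amb ϖ n), hk v v.2⟩)
  let u : (Fin n → A) →ₗ[A] E := LinearMap.codRestrict E (ϖ ^ l • std ϖ n) fun v => hl v
  have huw : u ∘ₗ w = (ϖ ^ (l + k)) • LinearMap.id := by
    ext1 v
    apply Subtype.ext
    change ϖ ^ l • std ϖ n (w v) = ϖ ^ (l + k) • (v : Amb ϖ n)
    rw [hw, pow_add, mul_smul]
  have hstd : ∀ z, std ϖ' n (TensorProduct.piScalarRight A B B (Fin n) (w.baseChange B z)) =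
      ϖ' ^ k • Φ z := by
    intro z
    induction z with
    | zero => simp
    | tmul b v =>
      have h1 : ϖ' ^ k • bcMap f hf (v : Amb ϖ n) = bcMap f hf (std ϖ n (w v)) := by
        rw [hw, map_smulₛₗ, map_pow, hf]
      rw [hΦ, smul_comm, h1]
      ext i
      simp [bcMap, Algebra.smul_def, halg, mul_comm]
    | add x y hx hy => simp only [map_add, hx, hy, smul_add]
  have hinj : Function.Injective Φ := by
    rw [injective_iff_map_eq_zero]
    intro z hz
    have h1 : w.baseChange B z = 0 := by
      have := hstd z
      rw [hz, smul_zero] at this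
      exact (TensorProduct.piScalarRight A B B (Fin n)).map_eq_zero_iff.1
        ((map_eq_zero_iff _ (std_injective hϖ' n)).1 this)
    have h2 : (u ∘ₗ w).baseChange B z = 0 := by
      rw [LinearMap.baseChange_comp, LinearMap.comp_apply, h1, map_zero]
    rw [huw, LinearMap.baseChange_smul, LinearMap.baseChange_id, LinearMap.smul_apply,
      LinearMap.id_apply, ← algebraMap_smul B, halg, map_pow, hf] at h2
    exact Module.Flat.isSMulRegular_of_nonZeroDivisors (pow_mem hϖ' (l + k))
      (by simpa using h2)
  let e : (B ⊗[A] E) ≃ₗ[B] AffGr.baseChange f hf E :=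
    (LinearEquiv.ofInjective Φ hinj).trans (LinearEquiv.ofEq _ _ hrange)
  refine ⟨Module.Finite.equiv e, Module.Projective.of_equiv e, fun P => ?_, ?_⟩
  · rw [← Module.rankAtStalk_eq_of_equiv e, Module.rankAtStalk_baseChange, hE.rank]
  · rw [eq_top_iff, ← (Pi.basisFun (Localization.Away ϖ') (Fin n)).span_eq, Submodule.span_le]
    rintro _ ⟨i, rfl⟩
    have hmem : ∀ v : Amb ϖ n, (fun i => locMap f hf (v i)) ∈ Submodule.span
        (Localization.Away ϖ') (AffGr.baseChange f hf E : Set (Amb ϖ' n)) := by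
      intro v
      have hv : v ∈ Submodule.span (Localization.Away ϖ) (E : Set (Amb ϖ n)) :=
        hE.span_eq_top ▸ trivial
      induction hv using Submodule.span_induction with
      | mem x hx => exact Submodule.subset_span (Submodule.subset_span ⟨x, hx, rfl⟩)
      | zero => convert Submodule.zero_mem _ using 1; ext; simp
      | add x y _ _ hx hy => convert add_mem hx hy using 1; ext; simp
      | smul a x _ hx =>
        convert Submodule.smul_mem _ (locMap f hf a) hx using 1; ext; simp
    have h1 : Pi.basisFun (Localization.Away ϖ') (Fin n) i =
        fun j => locMap f hf ((Pi.single i 1 : Amb ϖ n) j) := by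
      ext j
      by_cases h : j = i
      · subst h; simp
      · simp [h]
    rw [h1]
    exact hmem _

/-- The automorphism of `A[1/ϖ]ⁿ` given by `g ∈ GLₙ(A)`. -/
def glEquiv {ϖ : A} {n : ℕ} (g : GL (Fin n) A) :
    Amb ϖ n ≃ₗ[Localization.Away ϖ] Amb ϖ n :=
  LinearMap.GeneralLinearGroup.generalLinearEquiv _ _
    (Matrix.GeneralLinearGroup.toLin (Matrix.GeneralLinearGroup.map (algebraMap A _) g))

theorem glAct_eq {ϖ : A} {n : ℕ} (g : GL (Fin n) A) (E : Submodule A (Amb ϖ n)) :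
    glAct g E = E.map ((glEquiv (ϖ := ϖ) g).restrictScalars A).toLinearMap := by
  rfl

theorem glEquiv_std {ϖ : A} {n : ℕ} (g : GL (Fin n) A) (v : Fin n → A) :
    glEquiv g (std ϖ n v) = std ϖ n ((g : Matrix (Fin n) (Fin n) A).mulVec v) := by
  change ((g : Matrix (Fin n) (Fin n) A).map (algebraMap A _)).mulVec (std ϖ n v) = _
  ext i
  simp [Matrix.mulVec, dotProduct]

theorem glAct_one {ϖ : A} {n : ℕ} (E : Submodule A (Amb ϖ n)) : glAct 1 E = E := by
  ext v; simp [glAct]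

theorem glAct_mul {ϖ : A} {n : ℕ} (g h : GL (Fin n) A) (E : Submodule A (Amb ϖ n)) :
    glAct (g * h) E = glAct g (glAct h E) := by
  rw [glAct, glAct, glAct, ← Submodule.map_comp]
  congr 1
  ext1 v
  simp [Matrix.map_mul]

theorem IsLattice.glAct {ϖ : A} {n : ℕ} (g : GL (Fin n) A) {E : Submodule A (Amb ϖ n)}
    (hE : IsLattice ϖ n E) : IsLattice ϖ n (AffGr.glAct g E) := by
  have := hE.finite
  have := hE.projective
  rw [glAct_eq]
  let e := ((glEquiv (ϖ := ϖ) g).restrictScalars A).submoduleMap E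
  refine ⟨Module.Finite.equiv e, Module.Projective.of_equiv e, fun P => ?_, ?_⟩
  · rw [← Module.rankAtStalk_eq_of_equiv e, hE.rank]
  · have := Submodule.map_span (glEquiv (ϖ := ϖ) g).toLinearMap (E : Set (Amb ϖ n))
    rw [hE.span_eq_top, Submodule.map_top, LinearEquiv.range] at this
    exact this.symm

theorem HasRelPos.glAct {ϖ : A} {n : ℕ} (g : GL (Fin n) A) {E : Submodule A (Amb ϖ n)}
    {m : Fin n → ℤ} (h : HasRelPos ϖ E m) : HasRelPos ϖ (AffGr.glAct g E) m := by
  obtain ⟨hm, b, rfl⟩ := h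
  refine ⟨hm, b.map (LinearMap.GeneralLinearGroup.generalLinearEquiv _ _
    (Matrix.GeneralLinearGroup.toLin g)), ?_⟩
  rw [glAct_eq, Submodule.map_span, ← Set.range_comp]
  congr 2
  ext1 i
  change glEquiv g _ = _
  rw [map_smul, glEquiv_std]
  rfl

theorem baseChange_glAct {ϖ : A} {ϖ' : B} {n : ℕ} (f : A →+* B) (hf : f ϖ = ϖ')
    (g : GL (Fin n) A) (E : Submodule A (Amb ϖ n)) :
    AffGr.baseChange f hf (AffGr.glAct g E) =
      AffGr.glAct (Matrix.GeneralLinearGroup.map f g) (AffGr.baseChange f hf E) := by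
  rw [glAct, glAct, baseChange, baseChange, Submodule.map_span, Submodule.map_coe,
    Set.image_image, Set.image_image]
  congr 2
  ext v i
  simp [Matrix.mulVec, dotProduct]

end Lattice

/-! ### The rings `𝒪_R` -/

section Witt

variable (p : ℕ) [Fact p.Prime] (k : Type u) [Field k]

/-- `W(R)` as a `W(k)`-algebra, for a `k`-algebra `R`. -/
abbrev wittAlgebra (R : Type u) [CommRing R] [Algebra k R] :
    Algebra (WittVector p k) (WittVector p R) :=
  (WittVector.map (algebraMap k R)).toAlgebra

attribute [local instance] wittAlgebra

/-- `W_𝒪(R) = W(R) ⊗_{W(k)} 𝒪`. -/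
def WittTensor (O : Type u) [CommRing O] [Algebra (WittVector p k) O]
    (R : Type u) [CommRing R] [Algebra k R] : Type u :=
  WittVector p R ⊗[WittVector p k] O

namespace WittTensor

variable (O : Type u) [CommRing O] [Algebra (WittVector p k) O]
variable {R S T : Type u} [CommRing R] [Algebra k R] [CommRing S] [Algebra k S]
  [CommRing T] [Algebra k T]

instance : CommRing (WittTensor p k O R) :=
  inferInstanceAs (CommRing (WittVector p R ⊗[WittVector p k] O))

/-- `x ↦ 1 ⊗ x`. -/
def ofBase : O →+* WittTensor p k O R :=
  (Algebra.TensorProduct.includeRight :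
    O →ₐ[WittVector p k] WittVector p R ⊗[WittVector p k] O).toRingHom

/-- `w ↦ w ⊗ 1`. -/
def ofWitt : WittVector p R →+* WittTensor p k O R :=
  (Algebra.TensorProduct.includeLeft :
    WittVector p R →ₐ[WittVector p k] WittVector p R ⊗[WittVector p k] O).toRingHom

/-- `W(f)` as a homomorphism of `W(k)`-algebras. -/
def wittMap (f : R →ₐ[k] S) : WittVector p R →ₐ[WittVector p k] WittVector p S where
  toRingHom := WittVector.map f.toRingHom
  commutes' x := by
    ext i
    simp [RingHom.algebraMap_toAlgebra]

/-- `W_𝒪(f) = W(f) ⊗ id`. -/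
def map (f : R →ₐ[k] S) : WittTensor p k O R →+* WittTensor p k O S :=
  (Algebra.TensorProduct.map (wittMap p k f) (AlgHom.id (WittVector p k) O)).toRingHom

theorem map_ofBase (f : R →ₐ[k] S) (x : O) :
    map p k O f (ofBase p k O x) = ofBase p k O x :=
  (Algebra.TensorProduct.map_tmul ..).trans (by simp only [map_one]; rfl)

theorem map_id : map p k O (AlgHom.id k R) = RingHom.id _ := by
  have h : wittMap p k (AlgHom.id k R) = AlgHom.id _ _ := by
    ext x i; simp [wittMap]
  rw [map, h, Algebra.TensorProduct.map_id]; rfl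

theorem map_comp (f : R →ₐ[k] S) (g : S →ₐ[k] T) :
    map p k O (g.comp f) = (map p k O g).comp (map p k O f) := by
  have h : wittMap p k (g.comp f) = (wittMap p k g).comp (wittMap p k f) := by
    ext x i; simp [wittMap, WittVector.map_coeff]
  have h2 := Algebra.TensorProduct.map_comp (R := WittVector p k) (S := WittVector p k)
    (wittMap p k g) (wittMap p k f) (AlgHom.id (WittVector p k) O) (AlgHom.id _ _)
  rw [AlgHom.id_comp, ← h] at h2
  rw [map, h2]; rfl

theorem ofBase_mem_nonZeroDivisors [CharP k p] [IsAlgClosed k] [PerfectRing R p] {x : O}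
    (hx : x ∈ O⁰) : (ofBase p k O x : WittTensor p k O R) ∈ (WittTensor p k O R)⁰ := by
  have htf : Module.IsTorsionFree (WittVector p k) (WittVector p R) := by
    rcases subsingleton_or_nontrivial R with hR | hR
    · have : Subsingleton (WittVector p R) := ⟨fun a b => by ext i; exact Subsingleton.elim _ _⟩
      exact ⟨fun r _ a b _ => Subsingleton.elim _ _⟩
    have : CharP R p := charP_of_injective_algebraMap (algebraMap k R).injective p
    refine ⟨fun r hr => ?_⟩
    have hr0 : r ≠ 0 := hr.ne_zero
    obtain ⟨m, b, rfl⟩ := WittVector.exists_eq_pow_p_mul' r hr0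
    have hp : IsSMulRegular (WittVector p R) (p : WittVector p k) := by
      refine IsSMulRegular.of_right_eq_zero_of_smul fun y hy => ?_
      apply WittVector.eq_zero_of_p_mul_eq_zero
      rw [Algebra.smul_def, map_natCast] at hy
      rwa [mul_comm]
    exact (hp.pow m).mul (b.isUnit.isSMulRegular _)
  have hflat : Module.Flat (WittVector p k) (WittVector p R) := inferInstance
  have hflat' : Module.Flat O (O ⊗[WittVector p k] WittVector p R) := inferInstance
  have hreg := Module.Flat.isSMulRegular_of_nonZeroDivisors
    (M := O ⊗[WittVector p k] WittVector p R) hx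
  rw [mem_nonZeroDivisors_iff_right]
  intro z hz
  let e : WittTensor p k O R ≃+* (O ⊗[WittVector p k] WittVector p R) :=
    (Algebra.TensorProduct.comm (WittVector p k) (WittVector p R) O).toRingEquiv
  apply e.injective
  rw [map_zero]
  have h1 : e (z * (ofBase p k O x : WittTensor p k O R)) = 0 := by rw [hz, map_zero]
  have h2 : e (ofBase p k O x : WittTensor p k O R) = x ⊗ₜ 1 :=
    Algebra.TensorProduct.comm_tmul ..
  have h3 : x • e z = 0 := by
    rw [Algebra.smul_def, mul_comm, ← h1, map_mul, h2]; rfl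
  exact hreg (by simpa using h3)

end WittTensor

end Witt

/-- The local fields: `F = k((t))`, with `𝒪 = k[[t]]` and uniformizer `t`; or a finite totally
ramified extension `F` of `W(k)[1/p]`, given by its ring of integers `𝒪` (a discrete valuation ring
which is finite over `W(k) ⊆ 𝒪` and has residue field `k`) and a uniformizer `ϖ`. -/
inductive LocalBase (p : ℕ) [Fact p.Prime] (k : Type u) [Field k] : Type (u + 1)
  | equal : LocalBase p k
  | mixed (O : Type u) [CommRing O] [IsDomain O] [IsDiscreteValuationRing O]
      [Algebra (WittVector p k) O] [Module.Finite (WittVector p k) O]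
      (inj : Function.Injective (algebraMap (WittVector p k) O))
      (ram : Function.Surjective
        ((IsLocalRing.residue O).comp (algebraMap (WittVector p k) O)))
      (ϖ : O) (irr : Irreducible ϖ) : LocalBase p k

namespace LocalBase

variable {p : ℕ} [Fact p.Prime] {k : Type u} [Field k] (D : LocalBase p k)

/-- The normalized valuation `v_F(p)`; it is `⊤` if `p = 0` in `F`. -/
def valP : LocalBase p k → ℕ∞
  | equal => IsDiscreteValuationRing.addVal (PowerSeries k) (p : PowerSeries k)
  | mixed O _ _ _ _ => IsDiscreteValuationRing.addVal O (p : O)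

/-- `𝒪_R`, which is `R[[t]]` or `W_𝒪(R)`. -/
def ring (D : LocalBase p k) (R : Type u) [CommRing R] [Algebra k R] : Type u :=
  match D with
  | equal => PowerSeries R
  | mixed O _ _ _ _ => WittTensor p k O R

variable {R S T : Type u} [CommRing R] [Algebra k R] [CommRing S] [Algebra k S]
  [CommRing T] [Algebra k T]

instance : CommRing (D.ring R) :=
  match D with
  | equal => inferInstanceAs (CommRing (PowerSeries R))
  | mixed O _ _ _ _ => inferInstanceAs (CommRing (WittTensor p k O R))

/-- The uniformizer in `𝒪_R`. -/
def unif (D : LocalBase p k) (R : Type u) [CommRing R] [Algebra k R] : D.ring R :=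
  match D with
  | equal => (PowerSeries.X : PowerSeries R)
  | mixed O _ _ ϖ _ => (WittTensor.ofBase p k O ϖ : WittTensor p k O R)

/-- The map `R → 𝒪_R`, `a ↦ [a]`: the Teichmüller lift in mixed characteristic, and `[a] = a` in
equal characteristic. -/
def teich (D : LocalBase p k) (a : R) : D.ring R :=
  match D with
  | equal => (PowerSeries.C a : PowerSeries R)
  | mixed O _ _ _ _ => WittTensor.ofWitt p k O (WittVector.teichmuller p a)

/-- The functoriality of `𝒪_R` in `R`. -/
def map (D : LocalBase p k) (f : R →ₐ[k] S) : D.ring R →+* D.ring S :=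
  match D with
  | equal => PowerSeries.map f.toRingHom
  | mixed O _ _ _ _ => WittTensor.map p k O f

theorem map_unif (f : R →ₐ[k] S) : D.map f (D.unif R) = D.unif S := by
  cases D with
  | equal => exact PowerSeries.map_X _
  | mixed O _ _ ϖ _ => exact WittTensor.map_ofBase p k O f ϖ

theorem map_id : D.map (AlgHom.id k R) = RingHom.id _ := by
  cases D with
  | equal => exact RingHom.ext fun φ => congrFun (PowerSeries.map_id (R := R)) φ
  | mixed O _ _ ϖ _ => exact WittTensor.map_id p k O

theorem map_comp (f : R →ₐ[k] S) (g : S →ₐ[k] T) : D.map (g.comp f) = (D.map g).comp (D.map f) := by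
  cases D with
  | equal => exact PowerSeries.map_comp f.toRingHom g.toRingHom
  | mixed O _ _ ϖ _ => exact WittTensor.map_comp p k O f g

theorem unif_mem_nonZeroDivisors [CharP k p] [IsAlgClosed k] [PerfectRing R p] :
    D.unif R ∈ (D.ring R)⁰ := by
  cases D with
  | equal =>
    exact mem_nonZeroDivisors_iff_right.2 fun φ h =>
      PowerSeries.mul_X_injective (R := R) (h.trans (zero_mul PowerSeries.X).symm)
  | mixed O _ _ ϖ irr =>
    exact WittTensor.ofBase_mem_nonZeroDivisors p k O (mem_nonZeroDivisors_of_ne_zero irr.ne_zero)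

/-- `𝒪_{R,N} = 𝒪_R/ϖᴺ`. -/
abbrev trunc (N : ℕ) (R : Type u) [CommRing R] [Algebra k R] : Type u :=
  D.ring R ⧸ Ideal.span {D.unif R ^ N}

/-- The class of `∑_{i < N} [aᵢ] ϖⁱ` in `𝒪_R/ϖᴺ`. -/
def digits (N : ℕ) (a : Fin N → R) : D.trunc N R :=
  Ideal.Quotient.mk _ (∑ i : Fin N, D.teich (a i) * D.unif R ^ (i : ℕ))

/-- The reduction map `L⁺GLₙ(R) = GLₙ(𝒪_R) → LᴺGLₙ(R) = GLₙ(𝒪_R/ϖᴺ)`. -/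
def red (n N : ℕ) (R : Type u) [CommRing R] [Algebra k R] :
    GL (Fin n) (D.ring R) →* GL (Fin n) (D.trunc N R) :=
  Matrix.GeneralLinearGroup.map (Ideal.Quotient.mk _)

end LocalBase

/-! ### The affine Grassmannian of `GLₙ` and its Schubert varieties -/

/-- The category of perfect `k`-algebras. Spaces over `k` are functors on it. -/
abbrev PerfAlg (p : ℕ) (k : Type u) [Field k] : Type (u + 1) :=
  ObjectProperty.FullSubcategory fun R : CommAlgCat.{u} k => PerfectRing R p

/-- The dominance order on cocharacters of `GLₙ`. -/
def DomLE {n : ℕ} (m l : Fin n → ℤ) : Prop :=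
  (∀ j, ∑ i ∈ Finset.Iic j, m i ≤ ∑ i ∈ Finset.Iic j, l i) ∧ ∑ i, m i = ∑ i, l i

section Gr

variable {p : ℕ} [Fact p.Prime] {k : Type u} [Field k] (D : LocalBase p k) (n : ℕ)

/-- `Inv(β_x) ≤ μ` at all points `x` of `Spec R`, for the lattice `E`: over the residue field `κ(x)`,
the relative position of `E ⊗ 𝒪_{κ(x)}` to the standard lattice is at most `μ`. -/
def InvLE {R : Type u} [CommRing R] [Algebra k R] (μ : Fin n → ℤ)
    (E : Submodule (D.ring R) (Amb (D.unif R) n)) : Prop :=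
  ∀ x : PrimeSpectrum R, ∃ m : Fin n → ℤ, DomLE m μ ∧
    HasRelPos (D.unif x.asIdeal.ResidueField)
      (baseChange (D.map (IsScalarTower.toAlgHom k R x.asIdeal.ResidueField)) (D.map_unif _) E) m

theorem InvLE.baseChange {R S : Type u} [CommRing R] [Algebra k R] [CommRing S] [Algebra k S]
    (f : R →ₐ[k] S) {μ : Fin n → ℤ} {E : Submodule (D.ring R) (Amb (D.unif R) n)}
    (h : InvLE D n μ E) : InvLE D n μ (AffGr.baseChange (D.map f) (D.map_unif f) E) := by
  intro y
  let x : PrimeSpectrum R := y.comap f.toRingHom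
  obtain ⟨m, hm, hE⟩ := h x
  refine ⟨m, hm, ?_⟩
  let g : x.asIdeal.ResidueField →ₐ[k] y.asIdeal.ResidueField :=
    Ideal.ResidueField.mapₐ x.asIdeal y.asIdeal f rfl
  have h1 := hE.baseChange (D.map g) (D.map_unif g)
  have hc : g.comp (IsScalarTower.toAlgHom k R x.asIdeal.ResidueField) =
      (IsScalarTower.toAlgHom k S y.asIdeal.ResidueField).comp f := by
    ext a
    exact Ideal.ResidueField.map_algebraMap _ _ f.toRingHom rfl a
  rw [← baseChange_comp _ _ _ _ _ (D.map_unif _) (D.map_comp _ g)] at h1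
  rw [← baseChange_comp _ _ _ _ _ (D.map_unif _) (D.map_comp f _)]
  simpa only [hc] using h1

theorem InvLE.glAct {R : Type u} [CommRing R] [Algebra k R] {μ : Fin n → ℤ}
    {E : Submodule (D.ring R) (Amb (D.unif R) n)} (g : GL (Fin n) (D.ring R))
    (h : InvLE D n μ E) : InvLE D n μ (AffGr.glAct g E) := by
  intro x
  obtain ⟨m, hm, hE⟩ := h x
  refine ⟨m, hm, ?_⟩
  rw [baseChange_glAct]
  exact hE.glAct _

variable [CharP k p] [IsAlgClosed k]

/-- The affine Grassmannian of `GLₙ` over `𝒪`: `Gr(R)` is the set of `𝒪_R`-lattices in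
`𝒪_R[1/ϖ]ⁿ`. -/
def Gr : PerfAlg p k ⥤ Type u where
  obj R := {E : Submodule (D.ring R.obj) (Amb (D.unif R.obj) n) // IsLattice (D.unif R.obj) n E}
  map {R S} f := TypeCat.ofHom fun E => ⟨baseChange (D.map f.hom.hom) (D.map_unif _) E.1, by
    have := R.property
    have := S.property
    exact E.2.baseChange D.unif_mem_nonZeroDivisors D.unif_mem_nonZeroDivisors _ _⟩
  map_id R := by
    refine ConcreteCategory.hom_ext _ _ fun E => Subtype.ext (baseChange_id _ _ D.map_id _)
  map_comp f g := by
    refine ConcreteCategory.hom_ext _ _ fun E => Subtype.ext (baseChange_comp _ _ _ _ _ _ (D.map_comp _ _) _)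

/-- The Schubert variety `Gr_{≤ μ} ⊆ Gr`. -/
def schubert (μ : Fin n → ℤ) : Subfunctor (Gr D n) where
  obj _ := {E | InvLE D n μ E.1}
  map f _ hE := InvLE.baseChange D n f.hom.hom hE

/-- `Gr_{≤ (N, 0, …, 0)}`, as a functor on perfect `k`-algebras. -/
def GrBar (N : ℕ) : PerfAlg p k ⥤ Type u :=
  (schubert D n fun i => if (i : ℕ) = 0 then (N : ℤ) else 0).toFunctor

variable {D n} {N : ℕ} {R : PerfAlg p k}

/-- The lattice underlying a point of `Gr_{≤ (N, 0, …, 0)}(R)`. -/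
def GrBar.lattice (E : (GrBar D n N).obj R) :
    Submodule (D.ring R.obj) (Amb (D.unif R.obj) n) :=
  E.1.1

/-- The action of `L⁺GLₙ(R) = GLₙ(𝒪_R)` on `Gr_{≤ (N, 0, …, 0)}(R)`. -/
instance : MulAction (GL (Fin n) (D.ring R.obj)) ((GrBar D n N).obj R) where
  smul g E := ⟨⟨glAct g E.1.1, E.1.2.glAct g⟩, InvLE.glAct D n g E.2⟩
  one_smul E := Subtype.ext (Subtype.ext (glAct_one E.1.1))
  mul_smul g h E := Subtype.ext (Subtype.ext (glAct_mul g h E.1.1))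

variable {D₁ D₂ : LocalBase p k}

/-- The isomorphism `α : Gr_{≤ (N, 0, …, 0)} ≅ Gr_{≤ (N, 0, …, 0)}` comes from the ring isomorphisms
`θ : 𝒪_{1,R}/ϖ₁ᴺ ≅ 𝒪_{2,R}/ϖ₂ᴺ`: with `E₀ = 𝒪_Rⁿ` on both sides, `ϖ₁ᴺE₀ ⊆ E ⊆ E₀` and
`ϖ₂ᴺE₀ ⊆ α(E) ⊆ E₀` for each point `E`, and `θ` carries `E/ϖ₁ᴺE₀` onto `α(E)/ϖ₂ᴺE₀`. -/
def ComesFrom (θ : ∀ R : PerfAlg p k, D₁.trunc N R.obj ≃+* D₂.trunc N R.obj)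
    (α : GrBar D₁ n N ≅ GrBar D₂ n N) : Prop :=
  ∀ (R : PerfAlg p k) (E : (GrBar D₁ n N).obj R),
    IsBetween N (GrBar.lattice E) ∧ IsBetween N (GrBar.lattice (α.hom.app R E)) ∧
    ∀ v : Fin n → D₁.trunc N R.obj, v ∈ reduction N (GrBar.lattice E) ↔
      (fun i => θ R (v i)) ∈ reduction N (GrBar.lattice (α.hom.app R E))

/-- `ρ` is the action of `LᴺGLₙ` on `Gr_{≤ (N, 0, …, 0)}` induced by that of `L⁺GLₙ`; it is unique, as
`L⁺GLₙ(R) → LᴺGLₙ(R)` is required to be surjective. -/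
def IsInducedAction (D : LocalBase p k) (n N : ℕ)
    (ρ : ∀ R : PerfAlg p k,
      GL (Fin n) (D.trunc N R.obj) →* Equiv.Perm ((GrBar D n N).obj R)) : Prop :=
  ∀ R : PerfAlg p k, Function.Surjective (D.red n N R.obj) ∧
    ∀ (g : GL (Fin n) (D.ring R.obj)) (E : (GrBar D n N).obj R),
      ρ R (D.red n N R.obj g) E = g • E

end Gr

end AffGr

end

noncomputable section

namespace AffGr

/-! ### Lattices: dual bases, integrality, and a criterion for projectivity. -/

section LatticeCriteria

variable {A B : Type u} [CommRing A] [CommRing B] {n : ℕ}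

/-! Since `N ≤ v(p)`, the power `ϖ ^ N` divides `p`. Teichmüller lifts are additive modulo `p`, so
`a ↦ [a]` is a ring homomorphism `R → 𝒪_R/ϖᴺ`, and it extends to `R[X] → 𝒪_R/ϖᴺ` with `X ↦ ϖ`. Digit
expansions modulo `ϖ ^ N` exist and are unique, so this map is surjective and its kernel consists of
the polynomials whose first `N` coefficients vanish (`ker_polyHom_eq`). That kernel does not depend
on the local field; both truncated rings are `R[X]/Xᴺ`, which gives `θ`.

A weight `m ≤ (N, 0, …, 0)` has all entries in `[0, N]`, so over a field the lattice lies between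
`ϖᴺ𝒪ⁿ` and `𝒪ⁿ`. A perfect ring is reduced, hence integrality in `𝒪_R[1/ϖ]` can be tested at the
points of `Spec R` (`mem_range_of_forall`). With a dual basis of the lattice this yields the same
inclusions over `R` (`IsLattice.isBetween_of_invLE`). Such a lattice is the preimage of its
reduction in `(𝒪_R/ϖᴺ)ⁿ`, so the only candidate for `α(E)` is the preimage of the image of that
reduction under `θ`, called `transfer`. Uniqueness, naturality and equivariance all follow from this
description.

What needs work is that `transfer` yields a point of the Schubert variety. Over a residue field, an
adapted basis is a matrix in `GLₙ`; it is carried over modulo `ϖ ^ N` and lifted again, so the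
relative position is kept (`HasRelPos.transfer`). For projectivity (`IsLattice.transfer`), a maximal
ideal `P` of `𝒪_{2,R}` contains `ϖ₂` and hence comes from a closed point of `Spec R`, whose fibre
now has `n` generators. Flatness of `E`, in the form that vectors of `E` dying in the fibre lie in
the kernel times `E`, passes to the transport (`transfer_ker_smul`). So `n` elements generate the
transport modulo `P`, and `IsBetween.isLattice` turns this into projectivity without assuming the
rings to be Noetherian. -/

theorem algebraMap_unif_eq (ϖ : A) :
    algebraMap A (Localization.Away ϖ) ϖ = (unifUnit ϖ : Localization.Away ϖ) := rfl

theorem unif_pow_smul_injective (ϖ : A) (k : ℕ) {M : Type u} [AddCommGroup M] [Module A M]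
    [Module (Localization.Away ϖ) M] [IsScalarTower A (Localization.Away ϖ) M] {x y : M}
    (h : ϖ ^ k • x = ϖ ^ k • y) : x = y := by
  have hu : IsUnit (algebraMap A (Localization.Away ϖ) (ϖ ^ k)) := by
    rw [map_pow, algebraMap_unif_eq]
    exact (unifUnit ϖ).isUnit.pow k
  rw [← algebraMap_smul (Localization.Away ϖ), ← algebraMap_smul (Localization.Away ϖ) (ϖ ^ k) y]
    at h
  exact hu.smul_left_cancel.1 h

/-- A lattice has a finite dual basis, whose functionals are given by row vectors over `A[1/ϖ]`. -/
theorem IsLattice.exists_dualBasis {ϖ : A} {E : Submodule A (Amb ϖ n)}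
    (hE : IsLattice ϖ n E) : ∃ (m : ℕ) (r φ : Fin m → Amb ϖ n), (∀ j, r j ∈ E) ∧
      (∀ j, ∀ v ∈ E, φ j ⬝ᵥ v ∈ (algebraMap A (Localization.Away ϖ)).range) ∧
      ∀ v, v = ∑ j, (φ j ⬝ᵥ v) • r j := by
  have := hE.finite
  have := hE.projective
  obtain ⟨m, f, g, -, -, hfg⟩ := Module.Finite.exists_comp_eq_id_of_projective A E
  obtain ⟨k, hk⟩ := exists_pow_smul_std_mem hE.span_eq_top
  obtain ⟨l, hl⟩ := exists_pow_smul_mem_range ((Module.Finite.iff_fg).1 hE.finite)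
  let u : (Fin n → A) →ₗ[A] E := LinearMap.codRestrict E (ϖ ^ k • std ϖ n) fun v => hk v
  have hu : ∀ w, (u w : Amb ϖ n) = ϖ ^ k • std ϖ n w := fun w => rfl
  -- The `j`-th coordinate of `g` extends to `A[1/ϖ]ⁿ`. As `ϖ ^ k` times the `i`-th unit vector lies
  -- in `E`, the value of the extension there is `ϖ ^ (-k)` times the value of `g` on that multiple.
  let φ : Fin m → Amb ϖ n := fun j i =>
    (((unifUnit ϖ ^ k)⁻¹ : (Localization.Away ϖ)ˣ) : Localization.Away ϖ) *
      algebraMap A _ (g (u (Pi.single i 1)) j)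
  have hφ : ∀ j, ∀ v : E, φ j ⬝ᵥ (v : Amb ϖ n) = algebraMap A _ (g v j) := by
    intro j v
    obtain ⟨w, hw⟩ := hl v v.2
    -- After multiplication by `ϖ ^ (k + l)` the vector comes from `Aⁿ`, where `g ∘ u` is determined
    -- by its values on unit vectors; the power of `ϖ` is cancelled in `A[1/ϖ]`.
    have hv : u w = ϖ ^ (k + l) • v := by
      apply Subtype.ext
      rw [hu, hw, pow_add, mul_smul]; rfl
    apply unif_pow_smul_injective ϖ (k + l)
    have h1 : ϖ ^ (k + l) • algebraMap A (Localization.Away ϖ) (g v j) =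
        algebraMap A _ (g (u w) j) := by
      rw [hv, map_smul, Pi.smul_apply, smul_eq_mul, map_mul, Algebra.smul_def]
    have h2 : ϖ ^ (k + l) • (φ j ⬝ᵥ (v : Amb ϖ n)) = ϖ ^ k • (φ j ⬝ᵥ std ϖ n w) := by
      rw [hw, dotProduct_smul, ← mul_smul, ← pow_add]
    rw [h1, h2]
    have h3 : g (u w) = ∑ i, w i • g (u (Pi.single i 1)) := by
      conv_lhs => rw [← Finset.univ_sum_single w, map_sum, map_sum]
      refine Finset.sum_congr rfl fun i _ => ?_
      rw [← map_smul, ← map_smul]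
      congr 2
      simp [← Pi.single_smul]
    rw [h3, Finset.sum_apply, map_sum, dotProduct, Finset.smul_sum]
    refine Finset.sum_congr rfl fun i _ => ?_
    rw [Pi.smul_apply, smul_eq_mul, map_mul, Algebra.smul_def, map_pow, algebraMap_unif_eq,
      std_apply, ← mul_assoc, ← mul_assoc, ← Units.val_pow_eq_pow_val, Units.mul_inv, one_mul,
      mul_comm]
  have key : ∀ v ∈ E, v = ∑ j, (φ j ⬝ᵥ v) • (f (Pi.single j 1) : Amb ϖ n) := by
    intro v hv
    have h1 : f (g ⟨v, hv⟩) = ⟨v, hv⟩ := LinearMap.congr_fun hfg ⟨v, hv⟩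
    conv_lhs =>
      rw [show v = ((⟨v, hv⟩ : E) : Amb ϖ n) from rfl, ← h1,
        ← Finset.univ_sum_single (g ⟨v, hv⟩), map_sum, Submodule.coe_sum]
    refine Finset.sum_congr rfl fun j _ => ?_
    rw [hφ j ⟨v, hv⟩, algebraMap_smul, ← Submodule.coe_smul, ← map_smul]
    congr 2
    simp [← Pi.single_smul]
  refine ⟨m, fun j => f (Pi.single j 1), φ, fun j => (f _).2, fun j v hv => ⟨_, (hφ j ⟨v, hv⟩).symm⟩,
    fun v => ?_⟩
  have hv : v ∈ Submodule.span (Localization.Away ϖ) (E : Set (Amb ϖ n)) :=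
    hE.span_eq_top ▸ trivial
  induction hv using Submodule.span_induction with
  | mem x hx => exact key x hx
  | zero => simp
  | add x y _ _ hx hy =>
    simp only [dotProduct_add, add_smul, Finset.sum_add_distrib]
    rw [← hx, ← hy]
  | smul a x _ hx =>
    simp only [dotProduct_smul, smul_assoc, ← Finset.smul_sum]
    rw [← hx]

theorem locMap_dotProduct {ϖ : A} {ϖ' : B} (f : A →+* B) (hf : f ϖ = ϖ') (v w : Amb ϖ n) :
    locMap f hf (v ⬝ᵥ w) = (fun i => locMap f hf (v i)) ⬝ᵥ fun i => locMap f hf (w i) := by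
  simp [dotProduct]

/-- If integrality in `A[1/ϖ]` can be checked after a family of base changes, then so can membership
in a lattice. -/
theorem IsLattice.mem_of_forall_baseChange {ϖ : A} {E : Submodule A (Amb ϖ n)}
    (hE : IsLattice ϖ n E) {ι : Type*} {C : ι → Type u} [∀ x, CommRing (C x)] {ϖ' : ∀ x, C x}
    (f : ∀ x, A →+* C x) (hf : ∀ x, f x ϖ = ϖ' x)
    (hint : ∀ y : Localization.Away ϖ,
      (∀ x, locMap (f x) (hf x) y ∈ (algebraMap (C x) (Localization.Away (ϖ' x))).range) →
      y ∈ (algebraMap A (Localization.Away ϖ)).range)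
    {v : Amb ϖ n} (hv : ∀ x, (fun i => locMap (f x) (hf x) (v i)) ∈ AffGr.baseChange (f x) (hf x) E) :
    v ∈ E := by
  obtain ⟨m, r, φ, hr, hφ, h⟩ := hE.exists_dualBasis
  rw [h v]
  refine sum_mem fun j _ => ?_
  -- The coordinates of `v` in the dual basis are integral after each base change, because the
  -- base-changed functional is integral on the generators of the base-changed lattice.
  obtain ⟨c, hc⟩ : φ j ⬝ᵥ v ∈ (algebraMap A (Localization.Away ϖ)).range := by
    refine hint _ fun x => ?_
    rw [locMap_dotProduct]
    have := hv x
    generalize (fun i => locMap (f x) (hf x) (v i)) = w at this ⊢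
    induction this using Submodule.span_induction with
    | mem w hw =>
      obtain ⟨e, he, rfl⟩ := hw
      obtain ⟨c, hc⟩ := hφ j e he
      rw [← locMap_dotProduct, ← hc, locMap_algebraMap]
      exact ⟨_, rfl⟩
    | zero => simp
    | add x y _ _ hx hy => rw [dotProduct_add]; exact add_mem hx hy
    | smul a x _ hx =>
      rw [dotProduct_smul, Algebra.smul_def]
      exact mul_mem ⟨_, rfl⟩ hx
  rw [← hc, algebraMap_smul]
  exact E.smul_mem _ (hr j)

/-- The vectors of a lattice which die under a base change come from the kernel of the base change:
lattices are flat. -/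
theorem IsLattice.std_mem_ker_smul {ϖ : A} {ϖ' : B} (hϖ' : ϖ' ∈ B⁰)
    {E : Submodule A (Amb ϖ n)} (hE : IsLattice ϖ n E) (f : A →+* B) (hf : f ϖ = ϖ')
    {v : Fin n → A} (hv : std ϖ n v ∈ E) (h0 : ∀ i, f (v i) = 0) :
    std ϖ n v ∈ RingHom.ker f • E := by
  obtain ⟨m, r, φ, hr, hφ, h⟩ := hE.exists_dualBasis
  rw [h (std ϖ n v)]
  refine sum_mem fun j _ => ?_
  obtain ⟨c, hc⟩ := hφ j _ hv
  rw [← hc, algebraMap_smul]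
  refine Submodule.smul_mem_smul ?_ (hr j)
  rw [RingHom.mem_ker]
  -- The coordinate is `φ j` paired with `v`, and `v` vanishes after base change; since `ϖ'` is a
  -- nonzerodivisor, vanishing may be checked in `B[1/ϖ']`.
  apply IsLocalization.injective (Localization.Away ϖ') (Submonoid.powers_le.2 hϖ')
  rw [← locMap_algebraMap f hf, hc, locMap_dotProduct]
  simp [h0, dotProduct]

theorem std_mem_of_isBetween {ϖ : A} {N : ℕ} {E : Submodule A (Amb ϖ n)} (hE : IsBetween N E)
    {v w : Fin n → A} (hv : std ϖ n v ∈ E)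
    (h : ∀ i, Ideal.Quotient.mk (Ideal.span {ϖ ^ N}) (v i) = Ideal.Quotient.mk _ (w i)) :
    std ϖ n w ∈ E := by
  have h1 : ∀ i, ∃ a, ϖ ^ N * a = w i - v i := fun i =>
    (Ideal.mem_span_singleton.1 ((Ideal.Quotient.mk_eq_mk_iff_sub_mem _ _).1 (h i).symm)).imp
      fun _ h => h.symm
  choose a ha using h1
  have : w = v + ϖ ^ N • a := by
    ext i
    simp [ha]
  rw [this, map_add, map_smul]
  exact add_mem hv (hE.1 a)

/-- A submodule `ϖᴺAⁿ ⊆ E ⊆ Aⁿ` spans `A[1/ϖ]ⁿ`. -/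
theorem IsBetween.span_eq_top {ϖ : A} {N : ℕ} {E : Submodule A (Amb ϖ n)} (hE : IsBetween N E) :
    Submodule.span (Localization.Away ϖ) (E : Set (Amb ϖ n)) = ⊤ := by
  rw [eq_top_iff, ← (Pi.basisFun (Localization.Away ϖ) (Fin n)).span_eq, Submodule.span_le]
  rintro _ ⟨i, rfl⟩
  have h1 : Pi.basisFun (Localization.Away ϖ) (Fin n) i = std ϖ n (Pi.single i 1) := by
    ext j
    by_cases h : j = i
    · subst h; simp
    · simp [h]
  have h2 : std ϖ n (Pi.single i 1) = ((unifUnit ϖ ^ N)⁻¹ : (Localization.Away ϖ)ˣ) •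
      ϖ ^ N • std ϖ n (Pi.single i 1) := by
    rw [← algebraMap_smul (Localization.Away ϖ) (ϖ ^ N), map_pow, algebraMap_unif_eq,
      ← Units.val_pow_eq_pow_val, ← Units.smul_def, inv_smul_smul]
  rw [h1, h2, Units.smul_def]
  exact Submodule.smul_mem _ _ (Submodule.subset_span (hE.1 _))

/-- Multiplication by `ϖ ^ N` embeds `Aⁿ` into `E`, and `E` embeds into `Aⁿ`. Both embeddings
survive localization and squeeze the rank. -/
theorem IsBetween.rankAtStalk {ϖ : A} (hϖ : ϖ ∈ A⁰) {N : ℕ} {E : Submodule A (Amb ϖ n)}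
    (hE : IsBetween N E) [Module.Finite A E] (P : PrimeSpectrum A) :
    Module.rankAtStalk E P = n := by
  let u : (Fin n → A) →ₗ[A] E := LinearMap.codRestrict E (ϖ ^ N • std ϖ n) fun v => hE.1 v
  have hu : Function.Injective u := by
    intro v w h
    exact std_injective hϖ n (unif_pow_smul_injective ϖ N (congrArg Subtype.val h))
  let w : E →ₗ[A] (Fin n → A) :=
    (LinearEquiv.ofInjective _ (std_injective hϖ n)).symm.toLinearMap ∘ₗ
      Submodule.inclusion hE.2
  have hw : Function.Injective w := (LinearEquiv.injective
    (LinearEquiv.ofInjective _ (std_injective hϖ n)).symm).comp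
      (Submodule.inclusion_injective hE.2)
  have hn : Module.rankAtStalk (Fin n → A) P = n := by
    have : Nontrivial A := PrimeSpectrum.nonempty_iff_nontrivial.1 ⟨P⟩
    rw [Module.rankAtStalk_eq_finrank_of_free]
    simp
  refine le_antisymm ?_ ?_
  · refine le_trans ?_ hn.le
    exact LinearMap.finrank_le_finrank_of_injective
      (f := LocalizedModule.map P.asIdeal.primeCompl w) (LocalizedModule.map_injective _ w hw)
  · refine le_trans hn.ge ?_
    exact LinearMap.finrank_le_finrank_of_injective
      (f := LocalizedModule.map P.asIdeal.primeCompl u) (LocalizedModule.map_injective _ u hu)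

/-- If `s` were a nonzerodivisor, `G` and `H` would commute up to nothing: `H * G` would be the same
scalar. In general, multiplying by the adjugate of `G` and by `det H` produces the factor `det G *
det H = (s * ϖ ^ N) ^ n`, of which only the power of `ϖ` can be cancelled; the factor `s ^ n`
remains. -/
theorem pow_mul_sub_eq_zero_of_mul_eq_scalar {ϖ s : A} (hϖ : ϖ ∈ A⁰) {N : ℕ}
    {G H : Matrix (Fin n) (Fin n) A} (h : G * H = (s * ϖ ^ N) • 1) :
    s ^ n • (H * G) = (s ^ (n + 1) * ϖ ^ N) • 1 := by
  have h1 : G.det * H.det = (s * ϖ ^ N) ^ n := by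
    rw [← Matrix.det_mul, h, Matrix.det_smul]; simp
  have h2 : G.det • (H * G) = (G.det * (s * ϖ ^ N)) • (1 : Matrix (Fin n) (Fin n) A) := by
    have h3 : G * (H * G) = (s * ϖ ^ N) • G := by
      rw [← Matrix.mul_assoc, h, Matrix.smul_mul, Matrix.one_mul]
    have := congrArg (fun X => G.adjugate * X) h3
    simp only [← Matrix.mul_assoc, Matrix.adjugate_mul, Matrix.mul_smul, Matrix.smul_mul,
      Matrix.one_mul] at this
    rw [this, smul_smul, mul_comm]
  have h4 := congrArg (fun X => H.det • X) h2
  simp only [smul_smul, ← mul_assoc] at h4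
  rw [mul_comm H.det, h1] at h4
  ext i j
  have h5 := congrFun (congrFun h4 i) j
  simp only [Matrix.smul_apply, smul_eq_mul] at h5 ⊢
  apply mul_cancel_left_mem_nonZeroDivisors (pow_mem hϖ (N * n)) |>.1
  rw [mul_pow, ← pow_mul] at h5
  linear_combination h5

/-- A submodule `ϖᴺAⁿ ⊆ E ⊆ Aⁿ` of finite type is a lattice if, modulo each maximal
ideal, it is generated by `n` elements. -/
theorem IsBetween.isLattice {ϖ : A} (hϖ : ϖ ∈ A⁰) {N : ℕ} {E : Submodule A (Amb ϖ n)}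
    (hE : IsBetween N E) (hfg : E.FG)
    (h : ∀ P : Ideal A, P.IsMaximal → ∃ e : Fin n → Amb ϖ n, (∀ i, e i ∈ E) ∧
      E ≤ Submodule.span A (Set.range e) ⊔ P • E) : IsLattice ϖ n E := by
  have hfin : Module.Finite A E := (Module.Finite.iff_fg).2 hfg
  -- Projectivity of a finite module amounts to the identity being a finite sum of rank-one maps.
  -- The scalars `a` for which `a • 1` is such a sum form an ideal, and it suffices that no maximal
  -- ideal contains it.
  suffices hone : (1 : Module.End A E) ∈ LinearMap.range (dualTensorHom A E E) from
    ⟨hfin, Module.Projective.of_one_mem_range_dualTensorHom hone, hE.rankAtStalk hϖ,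
      hE.span_eq_top⟩
  let I : Ideal A := (LinearMap.range (dualTensorHom A E E)).comap
    (LinearMap.toSpanSingleton A (Module.End A E) 1)
  suffices hI : I = ⊤ by
    have : (1 : A) ∈ I := hI ▸ trivial
    simpa [I] using this
  by_contra hI
  obtain ⟨P, hP, hIP⟩ := Ideal.exists_le_maximal I hI
  obtain ⟨e, he, hle⟩ := h P hP
  -- Nakayama's lemma: some `s ≡ 1` modulo `P` multiplies `E` into the span of the `e i`. The aim is
  -- that `s ^ (n + 2)` lies in the ideal `I`.
  obtain ⟨s, hs1, hs⟩ := Submodule.exists_sub_one_mem_and_smul_le_of_fg_of_le_sup hfg le_rfl hle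
  have hsP : s ∉ P := fun hs' => hP.ne_top ((Ideal.eq_top_iff_one _).2 (by
    simpa using sub_mem hs' hs1))
  refine hsP (hP.isPrime.mem_of_pow_mem (n + 2) (hIP ?_))
  choose g hg using fun i => hE.2 (he i)
  let G : Matrix (Fin n) (Fin n) A := fun i j => g j i
  have hG : ∀ v ∈ E, ∃ c : Fin n → A, s • v = std ϖ n (G.mulVec c) := by
    intro v hv
    obtain ⟨c, hc⟩ := (Submodule.mem_span_range_iff_exists_fun A).1
      (hs (Submodule.smul_mem_pointwise_smul v s E hv))
    refine ⟨c, ?_⟩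
    rw [← hc]
    have : G.mulVec c = ∑ i, c i • g i := by
      ext i
      simp [G, Matrix.mulVec, dotProduct, mul_comm]
    rw [this, map_sum]
    simp [hg]
  -- Since `ϖ ^ N` times a unit vector lies in `E`, its `s`-multiple is a combination of the columns
  -- of `G`. This produces a matrix inverse to `G` up to the scalar `s * ϖ ^ N`.
  choose H hH using fun j : Fin n => hG _ (hE.1 (Pi.single j 1))
  have hGH : G * (Matrix.of H).transpose = (s * ϖ ^ N) • 1 := by
    ext i j
    have h1 := congrFun (std_injective hϖ n ((map_smul (std ϖ n) (s * ϖ ^ N) _).trans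
      ((mul_smul s (ϖ ^ N) _).trans (hH j)))) i
    rw [Matrix.mul_apply]
    simp only [Matrix.mulVec, dotProduct, Pi.smul_apply, smul_eq_mul] at h1
    simp only [Matrix.transpose_apply, Matrix.of_apply, Matrix.smul_apply, smul_eq_mul]
    rw [← h1, Matrix.one_apply, Pi.single_apply]
  set H' := (Matrix.of H).transpose
  have hHG := pow_mul_sub_eq_zero_of_mul_eq_scalar hϖ hGH
  let w : E →ₗ[A] (Fin n → A) :=
    (LinearEquiv.ofInjective _ (std_injective hϖ n)).symm.toLinearMap ∘ₗ
      Submodule.inclusion hE.2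
  have hw : ∀ v : E, std ϖ n (w v) = v := fun v =>
    congrArg Subtype.val ((LinearEquiv.ofInjective _ (std_injective hϖ n)).apply_symm_apply
      (Submodule.inclusion hE.2 v))
  let L : (Fin n → A) →ₗ[A] (Fin n → A) := ϖ ^ N • LinearMap.id
  have hL : Function.Injective L := by
    intro a b hab
    ext i
    exact (mul_cancel_left_mem_nonZeroDivisors (pow_mem hϖ N)).1 (congrFun hab i)
  have hmem : ∀ v : E, (s ^ (n + 1) • (H'.mulVecLin ∘ₗ w)) v ∈ LinearMap.range L := by
    intro v
    obtain ⟨c, hc⟩ := hG v v.2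
    have hc' : s • w v = G.mulVec c := std_injective hϖ n (by rw [map_smul, hw, hc])
    refine ⟨s ^ (n + 1) • c, ?_⟩
    have h1 : s ^ (n + 1) • H'.mulVec (w v) = s ^ n • H'.mulVec (G.mulVec c) := by
      rw [← hc', Matrix.mulVec_smul, smul_smul, pow_succ]
    change ϖ ^ N • s ^ (n + 1) • c = s ^ (n + 1) • H'.mulVec (w v)
    rw [h1, Matrix.mulVec_mulVec, ← Matrix.smul_mulVec, hHG, Matrix.smul_mulVec, Matrix.one_mulVec,
      smul_smul, mul_comm]
  -- The coordinate map is `s ^ (n + 1) * ϖ ^ (-N) * H'`, which is integral on `E` by `hmem`.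
  -- Composed with `G` it is multiplication by `s ^ (n + 2)`, so its components paired with the `e
  -- j` represent that scalar endomorphism.
  let ψ : E →ₗ[A] (Fin n → A) := (LinearEquiv.ofInjective L hL).symm.toLinearMap ∘ₗ
    LinearMap.codRestrict (LinearMap.range L) (s ^ (n + 1) • (H'.mulVecLin ∘ₗ w)) hmem
  have hψ : ∀ v : E, ϖ ^ N • ψ v = s ^ (n + 1) • H'.mulVec (w v) := fun v =>
    congrArg Subtype.val ((LinearEquiv.ofInjective L hL).apply_symm_apply
      (LinearMap.codRestrict (LinearMap.range L) (s ^ (n + 1) • (H'.mulVecLin ∘ₗ w)) hmem v))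
  have hGψ : ∀ v : E, G.mulVec (ψ v) = s ^ (n + 2) • w v := by
    intro v
    apply hL
    change ϖ ^ N • G.mulVec (ψ v) = ϖ ^ N • s ^ (n + 2) • w v
    rw [← Matrix.mulVec_smul, hψ, Matrix.mulVec_smul, Matrix.mulVec_mulVec, hGH, Matrix.smul_mulVec,
      Matrix.one_mulVec, smul_smul, smul_smul]
    congr 1
    ring
  refine ⟨∑ j, (LinearMap.proj j ∘ₗ ψ : Module.Dual A E) ⊗ₜ[A] (⟨e j, he j⟩ : E), ?_⟩
  ext1 v
  apply Subtype.ext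
  simp only [map_sum, LinearMap.sum_apply, dualTensorHom_apply, Submodule.coe_sum,
    Submodule.coe_smul, LinearMap.comp_apply, LinearMap.proj_apply, LinearMap.toSpanSingleton_apply,
    LinearMap.smul_apply, Module.End.one_apply]
  rw [← hw v, ← map_smul, ← hGψ v]
  have : G.mulVec (ψ v) = ∑ i, ψ v i • g i := by
    ext i
    simp [G, Matrix.mulVec, dotProduct, mul_comm]
  rw [this, map_sum]
  simp [hg]

end LatticeCriteria

/-! ### Relative position and generators of fibres. -/

section RelPos

variable {A B : Type u} [CommRing A] [CommRing B] {n : ℕ}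

theorem unifUnit_zpow_smul_std {ϖ : A} {m : ℤ} (hm : 0 ≤ m) (v : Fin n → A) :
    ((unifUnit ϖ ^ m : (Localization.Away ϖ)ˣ) : Localization.Away ϖ) • std ϖ n v =
      std ϖ n (ϖ ^ m.toNat • v) := by
  obtain ⟨k, rfl⟩ := Int.eq_ofNat_of_zero_le hm
  rw [map_smul, ← algebraMap_smul (Localization.Away ϖ) (ϖ ^ _), map_pow, algebraMap_unif_eq]
  simp

theorem HasRelPos.isBetween {ϖ : A} {E : Submodule A (Amb ϖ n)} {m : Fin n → ℤ}
    (h : HasRelPos ϖ E m) {N : ℕ} (h0 : ∀ i, 0 ≤ m i) (hN : ∀ i, m i ≤ N) : IsBetween N E := by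
  obtain ⟨-, f, rfl⟩ := h
  constructor
  · intro v
    rw [← f.sum_repr v, map_sum, Finset.smul_sum]
    refine sum_mem fun i _ => ?_
    rw [map_smul, smul_comm]
    refine Submodule.smul_mem _ _ ?_
    have h1 : ϖ ^ N • std ϖ n (f i) = ϖ ^ (N - (m i).toNat) •
        ((unifUnit ϖ ^ m i : (Localization.Away ϖ)ˣ) : Localization.Away ϖ) • std ϖ n (f i) := by
      rw [unifUnit_zpow_smul_std (h0 i), map_smul, ← mul_smul, ← pow_add,
        Nat.sub_add_cancel (Int.toNat_le.2 (hN i))]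
    rw [h1]
    exact Submodule.smul_mem _ _ (Submodule.subset_span ⟨i, rfl⟩)
  · rw [Submodule.span_le]
    rintro _ ⟨i, rfl⟩
    exact ⟨_, (unifUnit_zpow_smul_std (h0 i) _).symm⟩

theorem exists_mem_of_mem_baseChange {ϖ : A} {ϖ' : B} (f : A →+* B) (hf : f ϖ = ϖ')
    (hsurj : Function.Surjective f) {E : Submodule A (Amb ϖ n)} {x : Amb ϖ' n}
    (hx : x ∈ baseChange f hf E) : ∃ e ∈ E, bcMap f hf e = x := by
  induction hx using Submodule.span_induction with
  | mem x hx => exact hx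
  | zero => exact ⟨0, E.zero_mem, map_zero _⟩
  | add x y _ _ hx hy =>
    obtain ⟨a, ha, rfl⟩ := hx
    obtain ⟨b, hb, rfl⟩ := hy
    exact ⟨a + b, add_mem ha hb, map_add _ _ _⟩
  | smul c x _ hx =>
    obtain ⟨a, ha, rfl⟩ := hx
    obtain ⟨c, rfl⟩ := hsurj c
    exact ⟨c • a, E.smul_mem _ ha, map_smulₛₗ _ _ _⟩

theorem bcMap_std {ϖ : A} {ϖ' : B} (f : A →+* B) (hf : f ϖ = ϖ') (v : Fin n → A) :
    bcMap f hf (std ϖ n v) = std ϖ' n fun i => f (v i) := by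
  ext i
  simp [bcMap]

/-- Generators of the fibre lift to `E` because `f` is surjective. Subtracting the right combination
of the lifts from a vector of `E` leaves a vector of `E` that dies in the fibre, and `hker` places
it in `RingHom.ker f • E`, hence in `P • E`. -/
theorem IsBetween.exists_generators_of_baseChange {ϖ : A} {ϖ' : B} (hϖ' : ϖ' ∈ B⁰) (f : A →+* B)
    (hf : f ϖ = ϖ') (hsurj : Function.Surjective f) {N : ℕ} {E : Submodule A (Amb ϖ n)}
    (hE : IsBetween N E)
    (hker : ∀ v, std ϖ n v ∈ E → (∀ i, f (v i) = 0) → std ϖ n v ∈ RingHom.ker f • E)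
    {P : Ideal A} (hP : RingHom.ker f ≤ P) {b : Fin n → Amb ϖ' n}
    (hb : baseChange f hf E = Submodule.span B (Set.range b)) :
    ∃ e : Fin n → Amb ϖ n, (∀ i, e i ∈ E) ∧ E ≤ Submodule.span A (Set.range e) ⊔ P • E := by
  have h1 : ∀ i, ∃ e ∈ E, bcMap f hf e = b i := fun i =>
    exists_mem_of_mem_baseChange f hf hsurj (hb ▸ Submodule.subset_span ⟨i, rfl⟩)
  choose e he heb using h1
  refine ⟨e, he, fun v hv => ?_⟩
  have h2 : bcMap f hf v ∈ Submodule.span B (Set.range b) :=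
    hb ▸ Submodule.subset_span ⟨v, hv, rfl⟩
  obtain ⟨c, hc⟩ := (Submodule.mem_span_range_iff_exists_fun B).1 h2
  choose a ha using fun i => hsurj (c i)
  have h3 : v - ∑ i, a i • e i ∈ E := sub_mem hv (sum_mem fun i _ => E.smul_mem _ (he i))
  obtain ⟨z, hz⟩ := hE.2 h3
  have h4 : bcMap f hf (v - ∑ i, a i • e i) = 0 := by
    simp only [map_sub, map_sum, map_smulₛₗ, heb, ha, hc, sub_self]
  rw [← hz, bcMap_std, map_eq_zero_iff _ (std_injective hϖ' n)] at h4
  rw [← sub_add_cancel v (∑ i, a i • e i), add_comm]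
  refine Submodule.add_mem_sup
    (sum_mem fun i _ => Submodule.smul_mem _ _ (Submodule.subset_span ⟨i, rfl⟩)) ?_
  rw [← hz] at h3 ⊢
  exact Submodule.smul_mono_left hP (hker z h3 (congrFun h4))

theorem exists_eq_add_of_mk_eq {ϖ : A} {N : ℕ} {z y : Fin n → A}
    (h : ∀ i, Ideal.Quotient.mk (Ideal.span {ϖ ^ N}) (z i) = Ideal.Quotient.mk _ (y i)) :
    ∃ a : Fin n → A, (∀ i, ϖ ^ N * a i = z i - y i) ∧
      z = y + ∑ i, a i • ϖ ^ N • Pi.single i 1 := by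
  have h1 : ∀ i, ∃ a, ϖ ^ N * a = z i - y i := fun i =>
    (Ideal.mem_span_singleton.1 ((Ideal.Quotient.mk_eq_mk_iff_sub_mem _ _).1 (h i))).imp
      fun _ h => h.symm
  choose a ha using h1
  refine ⟨a, ha, funext fun i => ?_⟩
  simp only [Pi.add_apply, Finset.sum_apply, Pi.smul_apply, Pi.single_apply, smul_eq_mul, mul_ite,
    mul_one, mul_zero, Finset.sum_ite_eq, Finset.mem_univ, if_true]
  linear_combination -ha i

end RelPos

/-! ### Transport of lattices along an isomorphism of truncated rings -/

section Transfer

variable {A₁ A₂ B₁ B₂ : Type u} [CommRing A₁] [CommRing A₂] [CommRing B₁] [CommRing B₂]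
  {ϖ₁ : A₁} {ϖ₂ : A₂} {ϖ₁' : B₁} {ϖ₂' : B₂} {n N : ℕ}

/-- The submodule of `A₂[1/ϖ₂]ⁿ` between `ϖ₂ᴺA₂ⁿ` and `A₂ⁿ` whose reduction corresponds to that of `E`
under `θ`. -/
def transfer (θ : A₁ ⧸ Ideal.span {ϖ₁ ^ N} ≃+* A₂ ⧸ Ideal.span {ϖ₂ ^ N})
    (E : Submodule A₁ (Amb ϖ₁ n)) : Submodule A₂ (Amb ϖ₂ n) :=
  Submodule.map (std ϖ₂ n)
    { carrier := {w | ∃ v, std ϖ₁ n v ∈ E ∧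
        ∀ i, θ (Ideal.Quotient.mk _ (v i)) = Ideal.Quotient.mk _ (w i)}
      add_mem' := by
        rintro w w' ⟨v, hv, h⟩ ⟨v', hv', h'⟩
        exact ⟨v + v', by rw [map_add]; exact add_mem hv hv', fun i => by simp [h, h']⟩
      zero_mem' := ⟨0, by simp, fun i => by simp⟩
      smul_mem' := by
        rintro c w ⟨v, hv, h⟩
        obtain ⟨a, ha⟩ := Ideal.Quotient.mk_surjective (θ.symm (Ideal.Quotient.mk _ c))
        exact ⟨a • v, by rw [map_smul]; exact E.smul_mem _ hv, fun i => by simp [h, ha]⟩ }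

variable (θ : A₁ ⧸ Ideal.span {ϖ₁ ^ N} ≃+* A₂ ⧸ Ideal.span {ϖ₂ ^ N})

theorem exists_vec_lift (v : Fin n → A₁) : ∃ w : Fin n → A₂,
    ∀ i, θ (Ideal.Quotient.mk _ (v i)) = Ideal.Quotient.mk _ (w i) := by
  choose w hw using fun i => Ideal.Quotient.mk_surjective (θ (Ideal.Quotient.mk _ (v i)))
  exact ⟨w, fun i => (hw i).symm⟩

variable {θ} {E : Submodule A₁ (Amb ϖ₁ n)}

theorem std_mem_transfer_of {v : Fin n → A₁} {w : Fin n → A₂} (hv : std ϖ₁ n v ∈ E)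
    (h : ∀ i, θ (Ideal.Quotient.mk _ (v i)) = Ideal.Quotient.mk _ (w i)) :
    std ϖ₂ n w ∈ transfer θ E :=
  ⟨w, ⟨v, hv, h⟩, rfl⟩

theorem std_mem_transfer_iff (hϖ₂ : ϖ₂ ∈ A₂⁰) {w : Fin n → A₂} : std ϖ₂ n w ∈ transfer θ E ↔
    ∃ v, std ϖ₁ n v ∈ E ∧ ∀ i, θ (Ideal.Quotient.mk _ (v i)) = Ideal.Quotient.mk _ (w i) := by
  constructor
  · rintro ⟨w', h, he⟩
    rwa [← std_injective hϖ₂ n he]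
  · rintro ⟨v, hv, h⟩
    exact std_mem_transfer_of hv h

variable (θ E) in
theorem isBetween_transfer : IsBetween N (transfer θ E) := by
  constructor
  · intro v
    rw [← map_smul]
    refine std_mem_transfer_of (v := 0) (by simp) fun i => ?_
    rw [Pi.zero_apply, map_zero, map_zero, eq_comm, Ideal.Quotient.eq_zero_iff_mem]
    exact Ideal.mul_mem_right _ _ (Ideal.mem_span_singleton_self _)
  · rintro _ ⟨w, -, rfl⟩
    exact ⟨w, rfl⟩

theorem mem_reduction_transfer_iff (hϖ₂ : ϖ₂ ∈ A₂⁰) (v : Fin n → A₁ ⧸ Ideal.span {ϖ₁ ^ N}) :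
    v ∈ reduction N E ↔ (fun i => θ (v i)) ∈ reduction N (transfer θ E) := by
  constructor
  · rintro ⟨x, hx, rfl⟩
    obtain ⟨w, hw⟩ := exists_vec_lift θ x
    exact ⟨w, std_mem_transfer_of hx hw, funext fun i => (hw i).symm⟩
  · rintro ⟨w, hw, h⟩
    obtain ⟨x, hx, hxw⟩ := (std_mem_transfer_iff hϖ₂).1 hw
    exact ⟨x, hx, funext fun i => θ.injective ((hxw i).trans (congrFun h i))⟩

theorem IsBetween.le_of_reduction_subset {E' : Submodule A₁ (Amb ϖ₁ n)} (hE : IsBetween N E)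
    (hE' : IsBetween N E') (h : reduction N E ⊆ reduction N E') : E ≤ E' := by
  intro v hv
  obtain ⟨w, rfl⟩ := hE.2 hv
  obtain ⟨w', hw', e⟩ := h ⟨w, hv, rfl⟩
  exact std_mem_of_isBetween hE' hw' (congrFun e)

theorem IsBetween.eq_of_reduction_eq {E' : Submodule A₁ (Amb ϖ₁ n)} (hE : IsBetween N E)
    (hE' : IsBetween N E') (h : reduction N E = reduction N E') : E = E' :=
  le_antisymm (hE.le_of_reduction_subset hE' h.le) (hE'.le_of_reduction_subset hE h.ge)

/-- A lattice is determined by its transport along `θ`. -/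
theorem IsBetween.eq_transfer (hϖ₂ : ϖ₂ ∈ A₂⁰) {E' : Submodule A₂ (Amb ϖ₂ n)}
    (hE' : IsBetween N E')
    (h : ∀ v : Fin n → A₁ ⧸ Ideal.span {ϖ₁ ^ N},
      v ∈ reduction N E ↔ (fun i => θ (v i)) ∈ reduction N E') : E' = transfer θ E := by
  refine hE'.eq_of_reduction_eq (isBetween_transfer θ E) (Set.ext fun w => ?_)
  have := (h fun i => θ.symm (w i)).symm.trans (mem_reduction_transfer_iff (θ := θ) hϖ₂ _)
  simpa using this

theorem transfer_symm_transfer (hϖ₁ : ϖ₁ ∈ A₁⁰) (hϖ₂ : ϖ₂ ∈ A₂⁰) (hE : IsBetween N E) :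
    transfer θ.symm (transfer θ E) = E := by
  refine (hE.eq_transfer hϖ₁ fun v => ?_).symm
  rw [mem_reduction_transfer_iff (θ := θ) hϖ₂]
  simp

theorem transfer_refl (hϖ₁ : ϖ₁ ∈ A₁⁰) (hE : IsBetween N E) :
    transfer (RingEquiv.refl (A₁ ⧸ Ideal.span {ϖ₁ ^ N})) E = E :=
  (hE.eq_transfer hϖ₁ fun _ => Iff.rfl).symm

/-- Generators of the transport of a lattice. -/
theorem transfer_span (hϖ₁ : ϖ₁ ∈ A₁⁰) {ι : Type*} {s : ι → Fin n → A₁} {w : ι → Fin n → A₂}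
    (h : ∀ j i, θ (Ideal.Quotient.mk _ (s j i)) = Ideal.Quotient.mk _ (w j i)) :
    transfer θ (Submodule.span A₁ (Set.range fun j => std ϖ₁ n (s j))) =
      Submodule.span A₂ ((Set.range fun j => std ϖ₂ n (w j)) ∪
        Set.range fun i : Fin n => ϖ₂ ^ N • std ϖ₂ n (Pi.single i 1)) := by
  apply le_antisymm
  · rintro _ ⟨z, ⟨v, hv, hvz⟩, rfl⟩
    -- Each vector of the span corresponds under `θ` to at least one vector in the span of the `w
    -- j`. Any other corresponding vector differs from it by a multiple of `ϖ₂ ^ N`, which accounts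
    -- for the second family of generators.
    have key : ∀ x ∈ Submodule.span A₁ (Set.range fun j => std ϖ₁ n (s j)),
        ∃ v y, std ϖ₁ n v = x ∧
          (∀ i, θ (Ideal.Quotient.mk _ (v i)) = Ideal.Quotient.mk _ (y i)) ∧
          std ϖ₂ n y ∈ Submodule.span A₂ (Set.range fun j => std ϖ₂ n (w j)) := by
      intro x hx
      induction hx using Submodule.span_induction with
      | mem x hx =>
        obtain ⟨j, rfl⟩ := hx
        exact ⟨s j, w j, rfl, h j, Submodule.subset_span ⟨j, rfl⟩⟩
      | zero => exact ⟨0, 0, by simp, by simp, by simp⟩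
      | add x x' _ _ hx hx' =>
        obtain ⟨v, y, rfl, h1, h2⟩ := hx
        obtain ⟨v', y', rfl, h1', h2'⟩ := hx'
        exact ⟨v + v', y + y', map_add _ _ _, fun i => by simp [h1, h1'],
          by rw [map_add]; exact add_mem h2 h2'⟩
      | smul a x _ hx =>
        obtain ⟨v, y, rfl, h1, h2⟩ := hx
        obtain ⟨b, hb⟩ := Ideal.Quotient.mk_surjective (θ (Ideal.Quotient.mk _ a))
        exact ⟨a • v, b • y, map_smul _ _ _, fun i => by simp [h1, hb],
          by rw [map_smul]; exact Submodule.smul_mem _ _ h2⟩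
    obtain ⟨v', y, hv', hy, hmem⟩ := key _ hv
    obtain rfl := std_injective hϖ₁ n hv'
    obtain ⟨a, -, ha⟩ := exists_eq_add_of_mk_eq fun i => (hvz i).symm.trans (hy i)
    rw [ha, map_add, map_sum]
    refine add_mem (Submodule.span_mono Set.subset_union_left hmem) (sum_mem fun i _ => ?_)
    rw [map_smul, map_smul]
    exact Submodule.smul_mem _ _ (Submodule.subset_span (Or.inr ⟨i, rfl⟩))
  · rw [Submodule.span_le]
    rintro _ (⟨j, rfl⟩ | ⟨i, rfl⟩)
    · exact std_mem_transfer_of (Submodule.subset_span ⟨j, rfl⟩) (h j)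
    · exact (isBetween_transfer θ _).1 _

theorem eq_span_of_le_range_std (hE : E ≤ LinearMap.range (std ϖ₁ n)) :
    E = Submodule.span A₁ (Set.range fun j : {v // std ϖ₁ n v ∈ E} => std ϖ₁ n j.1) := by
  apply le_antisymm
  · intro x hx
    obtain ⟨v, rfl⟩ := hE hx
    exact Submodule.subset_span ⟨⟨v, hx⟩, rfl⟩
  · rw [Submodule.span_le]
    rintro _ ⟨j, rfl⟩
    exact j.2

theorem transfer_fg (hϖ₁ : ϖ₁ ∈ A₁⁰) (hE : E ≤ LinearMap.range (std ϖ₁ n)) (hfg : E.FG) :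
    (transfer θ E).FG := by
  obtain ⟨m, x, hx⟩ := Submodule.fg_iff_exists_fin_generating_family.1 hfg
  have hx' : ∀ j, x j ∈ LinearMap.range (std ϖ₁ n) := fun j =>
    hE (hx ▸ Submodule.subset_span ⟨j, rfl⟩)
  choose s hs using hx'
  choose w hw using fun j => exists_vec_lift θ (s j)
  have h1 : E = Submodule.span A₁ (Set.range fun j => std ϖ₁ n (s j)) := by
    simp only [hs]; exact hx.symm
  rw [h1, transfer_span hϖ₁ hw]
  exact Submodule.fg_span ((Set.finite_range _).union (Set.finite_range _))

theorem glAct_transfer_le {g₁ : GL (Fin n) A₁} {g₂ : GL (Fin n) A₂}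
    (hg : Matrix.GeneralLinearGroup.map (θ.toRingHom.comp (Ideal.Quotient.mk _)) g₁ =
      Matrix.GeneralLinearGroup.map (Ideal.Quotient.mk _) g₂) :
    glAct g₂ (transfer θ E) ≤ transfer θ (glAct g₁ E) := by
  rintro _ ⟨_, ⟨w, ⟨v, hv, hvw⟩, rfl⟩, rfl⟩
  have h1 : ∀ i j, θ (Ideal.Quotient.mk _ (g₁ i j)) = Ideal.Quotient.mk _ (g₂ i j) := fun i j =>
    (Matrix.GeneralLinearGroup.ext_iff _ _).1 hg i j
  have h2 := glEquiv_std (ϖ := ϖ₂) g₂ w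
  change glEquiv g₂ (std ϖ₂ n w) ∈ _
  rw [h2]
  refine std_mem_transfer_of (v := (g₁ : Matrix (Fin n) (Fin n) A₁).mulVec v)
    ⟨_, hv, glEquiv_std (ϖ := ϖ₁) g₁ v⟩ fun i => ?_
  simp only [Matrix.mulVec, dotProduct, map_sum, map_mul, h1, hvw]

/-- One inclusion is `glAct_transfer_le`; the same inclusion for the inverse matrices and the
lattice `g₁E` gives the other. -/
theorem transfer_glAct {g₁ : GL (Fin n) A₁} {g₂ : GL (Fin n) A₂}
    (hg : Matrix.GeneralLinearGroup.map (θ.toRingHom.comp (Ideal.Quotient.mk _)) g₁ =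
      Matrix.GeneralLinearGroup.map (Ideal.Quotient.mk _) g₂) :
    transfer θ (glAct g₁ E) = glAct g₂ (transfer θ E) := by
  refine le_antisymm ?_ (glAct_transfer_le hg)
  have h1 := glAct_transfer_le (θ := θ) (E := glAct g₁ E) (g₁ := g₁⁻¹) (g₂ := g₂⁻¹)
    (by rw [map_inv, map_inv, hg])
  rw [← glAct_mul, inv_mul_cancel, glAct_one] at h1
  have h2 : glAct g₂ (glAct g₂⁻¹ (transfer θ (glAct g₁ E))) ≤ glAct g₂ (transfer θ E) :=
    Submodule.map_mono h1
  rwa [← glAct_mul, mul_inv_cancel, glAct_one] at h2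

/-- Elements of `GLₙ(A)` which agree modulo `ϖᴺ` act in the same way on the lattices between
`ϖᴺAⁿ` and `Aⁿ`. -/
theorem glAct_congr (hϖ₁ : ϖ₁ ∈ A₁⁰) {g h : GL (Fin n) A₁} (hE : IsBetween N E)
    (hgE : IsBetween N (glAct g E))
    (hgh : Matrix.GeneralLinearGroup.map (Ideal.Quotient.mk (Ideal.span {ϖ₁ ^ N})) g =
      Matrix.GeneralLinearGroup.map (Ideal.Quotient.mk _) h) : glAct g E = glAct h E := by
  have := transfer_glAct (θ := RingEquiv.refl (A₁ ⧸ Ideal.span {ϖ₁ ^ N})) (E := E) (g₁ := g)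
    (g₂ := h) hgh
  rwa [transfer_refl hϖ₁ hE, transfer_refl hϖ₁ hgE] at this

/-- An adapted basis is an invertible matrix. Its reduction is moved by `θ` and lifted to `GLₙ(A₂)`
by `hGL`; the columns of the lift form an adapted basis for the transport, as `θ` matches the
uniformizers. -/
theorem HasRelPos.transfer (hϖ₁ : ϖ₁ ∈ A₁⁰)
    (hθ : θ (Ideal.Quotient.mk _ ϖ₁) = Ideal.Quotient.mk _ ϖ₂)
    (hGL : Function.Surjective (Matrix.GeneralLinearGroup.map (n := Fin n)
      (Ideal.Quotient.mk (Ideal.span {ϖ₂ ^ N})))) {m : Fin n → ℤ} (h : HasRelPos ϖ₁ E m)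
    (h0 : ∀ i, 0 ≤ m i) (hN : ∀ i, m i ≤ N) : HasRelPos ϖ₂ (transfer θ E) m := by
  obtain ⟨hm, f, hf⟩ := h
  let F : GL (Fin n) A₁ := ⟨(Pi.basisFun A₁ (Fin n)).toMatrix f, f.toMatrix (Pi.basisFun A₁ (Fin n)),
    Module.Basis.toMatrix_mul_toMatrix_flip _ _, Module.Basis.toMatrix_mul_toMatrix_flip _ _⟩
  obtain ⟨g, hg⟩ := hGL (Matrix.GeneralLinearGroup.map
    (θ.toRingHom.comp (Ideal.Quotient.mk _)) F)
  let b : Module.Basis (Fin n) A₂ (Fin n → A₂) := (Pi.basisFun A₂ (Fin n)).map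
    (LinearMap.GeneralLinearGroup.generalLinearEquiv _ _ (Matrix.GeneralLinearGroup.toLin g))
  have hb : ∀ j i, b j i = g i j := by
    intro j i
    change (g : Matrix (Fin n) (Fin n) A₂).mulVec (Pi.basisFun A₂ (Fin n) j) i = _
    simp
  have h1 : ∀ j i, θ (Ideal.Quotient.mk _ (f j i)) = Ideal.Quotient.mk _ (b j i) := fun j i => by
    rw [hb]
    exact ((Matrix.GeneralLinearGroup.ext_iff _ _).1 hg i j).symm
  have key : HasRelPos ϖ₂ (Submodule.span A₂ (Set.range fun i =>
      ((unifUnit ϖ₂ ^ m i : (Localization.Away ϖ₂)ˣ) : Localization.Away ϖ₂) • std ϖ₂ n (b i))) m :=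
    ⟨hm, b, rfl⟩
  have h2 : E = Submodule.span A₁ (Set.range fun i => std ϖ₁ n (ϖ₁ ^ (m i).toNat • f i)) := by
    rw [hf]
    simp only [unifUnit_zpow_smul_std (h0 _)]
  convert key using 1
  have h3 := key.isBetween h0 hN
  rw [h2, transfer_span hϖ₁ (w := fun i => ϖ₂ ^ (m i).toNat • b i)
    (fun j i => by simp [h1, hθ]), Submodule.span_union]
  simp only [unifUnit_zpow_smul_std (h0 _)] at h3 ⊢
  -- The extra generators `ϖ₂ ^ N • eᵢ` are redundant: since `m i ≤ N`, the span of the scaled basis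
  -- already contains `ϖ₂ᴺA₂ⁿ`.
  rw [sup_eq_left, Submodule.span_le]
  rintro _ ⟨i, rfl⟩
  exact h3.1 _

/-- By `transfer_span` both sides are spanned by the images of the same corresponding vectors
together with the `ϖ₂' ^ N`-multiples of the unit vectors. -/
theorem transfer_baseChange (hϖ₁ : ϖ₁ ∈ A₁⁰) (hϖ₁' : ϖ₁' ∈ B₁⁰)
    {θ' : B₁ ⧸ Ideal.span {ϖ₁' ^ N} ≃+* B₂ ⧸ Ideal.span {ϖ₂' ^ N}}
    (f₁ : A₁ →+* B₁) (hf₁ : f₁ ϖ₁ = ϖ₁') (f₂ : A₂ →+* B₂) (hf₂ : f₂ ϖ₂ = ϖ₂')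
    (hθ : ∀ a b, θ (Ideal.Quotient.mk _ a) = Ideal.Quotient.mk _ b →
      θ' (Ideal.Quotient.mk _ (f₁ a)) = Ideal.Quotient.mk _ (f₂ b))
    (hE : E ≤ LinearMap.range (std ϖ₁ n)) :
    transfer θ' (baseChange f₁ hf₁ E) = baseChange f₂ hf₂ (transfer θ E) := by
  choose w hw using fun j : {v // std ϖ₁ n v ∈ E} => exists_vec_lift θ j.1
  have h1 : baseChange f₁ hf₁ E = Submodule.span B₁
      (Set.range fun j : {v // std ϖ₁ n v ∈ E} => std ϖ₁' n fun i => f₁ (j.1 i)) := by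
    conv_lhs => rw [eq_span_of_le_range_std hE]
    rw [baseChange_span, ← Set.range_comp]
    congr 2
    ext1 j
    exact bcMap_std f₁ hf₁ _
  rw [h1, transfer_span hϖ₁' (w := fun j i => f₂ (w j i)) fun j i => hθ _ _ (hw j i)]
  conv_rhs => rw [eq_span_of_le_range_std hE, transfer_span hϖ₁ hw, baseChange_span]
  rw [Set.image_union, ← Set.range_comp, ← Set.range_comp]
  congr 3
  · ext1 j
    exact (bcMap_std f₂ hf₂ _).symm
  · ext1 i
    change _ = bcMap f₂ hf₂ _
    rw [map_smulₛₗ, map_pow, hf₂, bcMap_std]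
    congr 2
    ext j
    by_cases h : j = i
    · subst h; simp
    · simp [h]

theorem exists_mk_eq_of_surjective {f : A₂ →+* B₂} (hf : f ϖ₂ = ϖ₂')
    (hsurj : Function.Surjective f) {a : A₂}
    (ha : Ideal.Quotient.mk (Ideal.span {ϖ₂' ^ N}) (f a) = 0) :
    ∃ a', f a' = 0 ∧ Ideal.Quotient.mk (Ideal.span {ϖ₂ ^ N}) a' = Ideal.Quotient.mk _ a := by
  obtain ⟨b, hb⟩ := Ideal.mem_span_singleton.1 (Ideal.Quotient.eq_zero_iff_mem.1 ha)
  obtain ⟨c, rfl⟩ := hsurj b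
  refine ⟨a - ϖ₂ ^ N * c, by simp [hb, hf], ?_⟩
  rw [Ideal.Quotient.mk_eq_mk_iff_sub_mem, Ideal.mem_span_singleton]
  exact ⟨-c, by ring⟩

/-- The consequence of flatness assumed in `hker` is a statement about vectors up to `ϖ ^
N`-multiples, and such multiples can be adjusted on either side without leaving the kernel of the
base change. This lets it pass through `θ`. -/
theorem transfer_ker_smul (hϖ₁ : ϖ₁ ∈ A₁⁰) (hϖ₂' : ϖ₂' ∈ B₂⁰) (hϖ₂ : ϖ₂ ∈ A₂⁰)
    {θ' : B₁ ⧸ Ideal.span {ϖ₁' ^ N} ≃+* B₂ ⧸ Ideal.span {ϖ₂' ^ N}}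
    {f₁ : A₁ →+* B₁} (hf₁ : f₁ ϖ₁ = ϖ₁') {f₂ : A₂ →+* B₂} (hf₂ : f₂ ϖ₂ = ϖ₂')
    (hs₁ : Function.Surjective f₁) (hs₂ : Function.Surjective f₂)
    (hθ : ∀ a b, θ (Ideal.Quotient.mk _ a) = Ideal.Quotient.mk _ b →
      θ' (Ideal.Quotient.mk _ (f₁ a)) = Ideal.Quotient.mk _ (f₂ b))
    (hE : IsBetween N E)
    (hker : ∀ v, std ϖ₁ n v ∈ E → (∀ i, f₁ (v i) = 0) → std ϖ₁ n v ∈ RingHom.ker f₁ • E)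
    {w : Fin n → A₂} (hw : std ϖ₂ n w ∈ transfer θ E) (hw0 : ∀ i, f₂ (w i) = 0) :
    std ϖ₂ n w ∈ RingHom.ker f₂ • transfer θ E := by
  have key : ∀ x ∈ RingHom.ker f₁ • E, ∃ v y, std ϖ₁ n v = x ∧
      (∀ i, θ (Ideal.Quotient.mk _ (v i)) = Ideal.Quotient.mk _ (y i)) ∧ (∀ i, f₂ (y i) = 0) ∧
      std ϖ₂ n y ∈ RingHom.ker f₂ • transfer θ E := by
    intro x hx
    induction hx using Submodule.smul_induction_on' with
    | smul a ha e he =>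
      obtain ⟨z, rfl⟩ := hE.2 he
      obtain ⟨z', hz'⟩ := exists_vec_lift θ z
      obtain ⟨b, hb⟩ := Ideal.Quotient.mk_surjective (θ (Ideal.Quotient.mk _ a))
      have h1 := hθ a b hb.symm
      rw [show f₁ a = 0 from ha, map_zero, map_zero] at h1
      obtain ⟨b', hb', hbb⟩ := exists_mk_eq_of_surjective hf₂ hs₂ h1.symm
      refine ⟨a • z, b' • z', map_smul _ _ _, fun i => ?_, fun i => by simp [hb'], ?_⟩
      · simp [hz', ← hb, hbb]
      · rw [map_smul]
        exact Submodule.smul_mem_smul hb' (std_mem_transfer_of he hz')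
    | add x _ x' _ hx hx' =>
      obtain ⟨v, y, rfl, h1, h2, h3⟩ := hx
      obtain ⟨v', y', rfl, h1', h2', h3'⟩ := hx'
      exact ⟨v + v', y + y', map_add _ _ _, fun i => by simp [h1, h1'], fun i => by simp [h2, h2'],
        by rw [map_add]; exact add_mem h3 h3'⟩
  obtain ⟨v, hv, hvw⟩ := (std_mem_transfer_iff hϖ₂).1 hw
  have h0 : ∀ i, Ideal.Quotient.mk (Ideal.span {ϖ₁' ^ N}) (f₁ (v i)) = 0 := fun i => by
    rw [← map_eq_zero_iff θ' θ'.injective, hθ _ _ (hvw i), hw0, map_zero]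
  -- The vector `v` corresponding to `w` dies in the fibre only modulo `ϖ₁' ^ N`. A correction by a
  -- multiple of `ϖ₁ ^ N` makes it die exactly and keeps it in `E`.
  choose v' hv' hvv using fun i => exists_mk_eq_of_surjective hf₁ hs₁ (h0 i)
  have hv'E := std_mem_of_isBetween hE hv fun i => (hvv i).symm
  obtain ⟨v'', y, hv'', hvy, hy0, hy⟩ := key _ (hker v' hv'E hv')
  obtain rfl := std_injective hϖ₁ n hv''
  obtain ⟨a, ha, h2⟩ := exists_eq_add_of_mk_eq fun i =>
    (hvw i).symm.trans ((congrArg θ (hvv i).symm).trans (hvy i))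
  -- Both `w` and `y` die under `f₂`, so `ϖ₂' ^ N` kills the image of `a i`; it is a nonzerodivisor.
  have ha0 : ∀ i, a i ∈ RingHom.ker f₂ := fun i => by
    have := congrArg f₂ (ha i)
    rw [map_sub, hw0, hy0, sub_zero, map_mul, map_pow, hf₂] at this
    exact (mul_right_mem_nonZeroDivisors_eq_zero_iff (pow_mem hϖ₂' N)).1
      ((mul_comm _ _).trans this)
  rw [h2, map_add, map_sum]
  refine add_mem hy (sum_mem fun i _ => ?_)
  rw [map_smul, map_smul]
  exact Submodule.smul_mem_smul (ha0 i) ((isBetween_transfer θ E).1 _)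

end Transfer

/-! ### The ring `W_𝒪(R)`: residue map and maximal ideals. -/

section WittTensorFacts

variable (p : ℕ) [Fact p.Prime] (k : Type u) [Field k]

attribute [local instance] wittAlgebra

namespace WittTensor

variable (O : Type u) [CommRing O] [Algebra (WittVector p k) O]
variable {R S : Type u} [CommRing R] [Algebra k R] [CommRing S] [Algebra k S]

theorem ofWitt_map_eq_ofBase (c : WittVector p k) :
    (ofWitt p k O (WittVector.map (algebraMap k R) c) : WittTensor p k O R) =
      ofBase p k O (algebraMap _ O c) :=
  ((Algebra.TensorProduct.includeLeft :
    WittVector p R →ₐ[WittVector p k] WittVector p R ⊗[WittVector p k] O).commutes c).trans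
  ((Algebra.TensorProduct.includeRight :
    O →ₐ[WittVector p k] WittVector p R ⊗[WittVector p k] O).commutes c).symm

variable {p k O} in
@[elab_as_elim]
theorem induction_on {motive : WittTensor p k O R → Prop} (z : WittTensor p k O R)
    (zero : motive 0) (mul : ∀ w o, motive (ofWitt p k O w * ofBase p k O o))
    (add : ∀ x y, motive x → motive y → motive (x + y)) : motive z := by
  refine TensorProduct.induction_on (motive := motive) z zero (fun w o => ?_) add
  have h : (w ⊗ₜ[WittVector p k] (1 : O)) * ((1 : WittVector p R) ⊗ₜ o) = w ⊗ₜ[WittVector p k] o := by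
    rw [Algebra.TensorProduct.tmul_mul_tmul, mul_one, one_mul]
  exact h ▸ mul w o

theorem exists_lift {C : Type u} [CommRing C] (f : WittVector p R →+* C) (g : O →+* C)
    (h : ∀ c, f (WittVector.map (algebraMap k R) c) = g (algebraMap _ O c)) :
    ∃ F : WittTensor p k O R →+* C, (∀ w, F (ofWitt p k O w) = f w) ∧
      ∀ o, F (ofBase p k O o) = g o := by
  let _ : Algebra (WittVector p k) C := (g.comp (algebraMap _ O)).toAlgebra
  let f' : WittVector p R →ₐ[WittVector p k] C := { f with commutes' := h }
  let g' : O →ₐ[WittVector p k] C := { g with commutes' := fun _ => rfl }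
  let F : WittVector p R ⊗[WittVector p k] O →ₐ[WittVector p k] C :=
    Algebra.TensorProduct.lift f' g' fun _ _ => Commute.all _ _
  refine ⟨F.toRingHom, fun w => ?_, fun o => ?_⟩
  · refine (Algebra.TensorProduct.lift_tmul f' g' _ w 1).trans ?_
    rw [map_one, mul_one]; rfl
  · refine (Algebra.TensorProduct.lift_tmul f' g' _ 1 o).trans ?_
    rw [map_one, one_mul]; rfl

theorem map_ofWitt (f : R →ₐ[k] S) (w : WittVector p R) :
    map p k O f (ofWitt p k O w) = ofWitt p k O (WittVector.map f.toRingHom w) :=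
  (Algebra.TensorProduct.map_tmul ..).trans (by simp only [map_one]; rfl)

theorem map_surjective (f : R →ₐ[k] S) (hf : Function.Surjective f) :
    Function.Surjective (map p k O f : WittTensor p k O R →+* WittTensor p k O S) := by
  intro z
  induction z using induction_on with
  | zero => exact ⟨0, map_zero _⟩
  | mul w o =>
    obtain ⟨w, rfl⟩ := WittVector.map_surjective f.toRingHom hf w
    exact ⟨ofWitt p k O w * ofBase p k O o, by rw [map_mul, map_ofWitt, map_ofBase]⟩
  | add x y hx hy =>
    obtain ⟨x, rfl⟩ := hx
    obtain ⟨y, rfl⟩ := hy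
    exact ⟨x + y, map_add _ _ _⟩

variable {O}

theorem coeff_zero_mem_span [CharP k p] [PerfectRing R p] {w : WittVector p R}
    (hw : w.coeff 0 = 0) : w ∈ Ideal.span {(p : WittVector p R)} := by
  rcases subsingleton_or_nontrivial R with hR | hR
  · have : w = 0 := by ext i; exact Subsingleton.elim _ _
    rw [this]; exact zero_mem _
  · have : CharP R p := charP_of_injective_algebraMap (algebraMap k R).injective p
    exact (WittVector.mem_span_p_iff_coeff_zero_eq_zero w).2 hw

/-- For perfect `R` the ring `W(R)` is `p`-adically complete, so `p` lies in its Jacobson radical.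
-/
theorem p_mem_of_isMaximal [CharP k p] [PerfectRing R p] {M : Ideal (WittVector p R)}
    (hM : M.IsMaximal) : (p : WittVector p R) ∈ M := by
  rcases subsingleton_or_nontrivial R with hR | hR
  · have : (p : WittVector p R) = 0 := by ext i; exact Subsingleton.elim _ _
    rw [this]; exact zero_mem _
  · have : CharP R p := charP_of_injective_algebraMap (algebraMap k R).injective p
    have h := IsAdicComplete.le_jacobson_bot (Ideal.span {(p : WittVector p R)})
    exact (h.trans (sInf_le ⟨bot_le, hM⟩)) (Ideal.mem_span_singleton_self _)

variable [IsDomain O] [IsDiscreteValuationRing O]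

/-- A Witt vector over `k` with nonzero constant coefficient is a unit and cannot die in the residue
field of `O`. Hence the constant coefficient factors through that field, which is a quotient of
`W(k)` by total ramification. -/
theorem exists_ringHom_residue [CharP k p]
    (ram : Function.Surjective ((IsLocalRing.residue O).comp (algebraMap (WittVector p k) O))) :
    ∃ c : O →+* k, (∀ w : WittVector p k, c (algebraMap _ O w) = w.coeff 0) ∧
      ∀ x, c x = 0 ↔ x ∈ IsLocalRing.maximalIdeal O := by
  have hker : RingHom.ker ((IsLocalRing.residue O).comp (algebraMap (WittVector p k) O)) ≤
      RingHom.ker (WittVector.constantCoeff : WittVector p k →+* k) := by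
    intro w hw
    by_contra h
    exact not_isUnit_zero (M₀ := IsLocalRing.ResidueField O)
      (hw ▸ (WittVector.isUnit_of_coeff_zero_ne_zero w h).map
        ((IsLocalRing.residue O).comp (algebraMap (WittVector p k) O)))
  let ψ : IsLocalRing.ResidueField O →+* k := RingHom.liftOfSurjective _ ram ⟨_, hker⟩
  refine ⟨ψ.comp (IsLocalRing.residue O), fun w => ?_, fun x => ?_⟩
  · exact RingHom.liftOfSurjective_comp_apply _ ram ⟨_, hker⟩ w
  · rw [RingHom.comp_apply, map_eq_zero, IsLocalRing.residue_eq_zero_iff]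

theorem exists_residue [CharP k p] [PerfectRing R p]
    (ram : Function.Surjective ((IsLocalRing.residue O).comp (algebraMap (WittVector p k) O)))
    {ϖ : O} (irr : Irreducible ϖ) : ∃ π : WittTensor p k O R →+* R,
      (∀ a, π (ofWitt p k O (WittVector.teichmuller p a)) = a) ∧
        ∀ x, π x = 0 ↔ x ∈ Ideal.span {(ofBase p k O ϖ : WittTensor p k O R)} := by
  obtain ⟨c, hc, hc0⟩ := exists_ringHom_residue p k ram
  rw [irr.maximalIdeal_eq] at hc0
  obtain ⟨π, hπ₁, hπ₂⟩ := exists_lift p k O (R := R) WittVector.constantCoeff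
    ((algebraMap k R).comp c) fun w => by rw [RingHom.comp_apply, hc]; rfl
  have hϖ : π (ofBase p k O ϖ) = 0 := by
    rw [hπ₂, RingHom.comp_apply, (hc0 ϖ).2 (Ideal.mem_span_singleton_self _), map_zero]
  refine ⟨π, fun a => by rw [hπ₁]; exact WittVector.teichmuller_coeff_zero p a,
    fun x => ⟨fun hx => ?_, fun hx => ?_⟩⟩
  -- Since `W(k)` surjects onto the residue field of `O`, every element is a Witt vector modulo `ϖ`.
  -- If its residue vanishes, the Witt vector is divisible by `p`, hence by `ϖ`.
  · have key : ∀ z : WittTensor p k O R, ∃ w y,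
        z = ofWitt p k O w + ofBase p k O ϖ * y := by
      intro z
      induction z using induction_on with
      | zero => exact ⟨0, 0, by simp⟩
      | mul w o =>
        obtain ⟨d, hd⟩ := ram (IsLocalRing.residue O o)
        have h1 : o - algebraMap _ O d ∈ Ideal.span {ϖ} := by
          rw [← irr.maximalIdeal_eq, ← IsLocalRing.residue_eq_zero_iff, map_sub, ← hd]
          exact sub_self _
        obtain ⟨o', ho'⟩ := Ideal.mem_span_singleton.1 h1
        refine ⟨w * WittVector.map (algebraMap k R) d, ofWitt p k O w * ofBase p k O o', ?_⟩
        rw [eq_add_of_sub_eq' ho', map_add, map_mul, map_mul, ofWitt_map_eq_ofBase]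
        ring
      | add x y hx hy =>
        obtain ⟨w, z, rfl⟩ := hx
        obtain ⟨w', z', rfl⟩ := hy
        exact ⟨w + w', z + z', by rw [map_add]; ring⟩
    obtain ⟨w, y, rfl⟩ := key x
    rw [map_add, map_mul, hϖ, zero_mul, add_zero, hπ₁] at hx
    obtain ⟨w', rfl⟩ := Ideal.mem_span_singleton.1 (coeff_zero_mem_span p k hx)
    have hp : (p : O) ∈ Ideal.span {ϖ} := (hc0 _).1 (by rw [map_natCast, CharP.cast_eq_zero])
    obtain ⟨q, hq⟩ := Ideal.mem_span_singleton.1 hp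
    refine Ideal.mem_span_singleton.2 ⟨ofBase p k O q * ofWitt p k O w' + y, ?_⟩
    rw [mul_add, ← mul_assoc, ← map_mul, ← hq, map_mul, map_natCast, map_natCast]
  · obtain ⟨y, rfl⟩ := Ideal.mem_span_singleton.1 hx
    rw [map_mul, hϖ, zero_mul]

/-- `W_𝒪(R)` is integral over `W(R)`, so a maximal ideal contracts to a maximal ideal and contains
`p`; a power of `ϖ` is a multiple of `p` in `O`. -/
theorem ofBase_mem_of_isMaximal [CharP k p] [PerfectRing R p] [Module.Finite (WittVector p k) O]
    (inj : Function.Injective (algebraMap (WittVector p k) O)) {ϖ : O} (irr : Irreducible ϖ)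
    {M : Ideal (WittTensor p k O R)} (hM : M.IsMaximal) : ofBase p k O ϖ ∈ M := by
  have hp0 : (p : O) ≠ 0 := by
    rw [← map_natCast (algebraMap (WittVector p k) O), Ne, map_eq_zero_iff _ inj]
    exact WittVector.p_nonzero p k
  obtain ⟨m, q, hq⟩ := IsDiscreteValuationRing.associated_pow_irreducible hp0 irr
  have hint : (ofWitt p k O : WittVector p R →+* WittTensor p k O R).IsIntegral := fun x =>
    (inferInstance : Algebra.IsIntegral (WittVector p R)
      (WittVector p R ⊗[WittVector p k] O)).isIntegral x
  have h1 := p_mem_of_isMaximal p k (Ideal.isMaximal_comap_of_isIntegral_of_isMaximal' _ hint M)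
  have h2 : (p : WittTensor p k O R) ∈ M := by
    rw [← map_natCast (ofWitt p k O)]
    exact h1
  refine hM.isPrime.mem_of_pow_mem m ?_
  rw [← map_pow, ← hq, map_mul, map_natCast]
  exact M.mul_mem_right _ h2

end WittTensor

end WittTensorFacts

theorem dvd_of_mul_dvd_mul_left_of_mem_nonZeroDivisors {A : Type u} [CommRing A] {a b c : A}
    (hc : c ∈ A⁰) (h : c * a ∣ c * b) : a ∣ b := by
  obtain ⟨d, hd⟩ := h
  exact ⟨d, (mul_cancel_left_mem_nonZeroDivisors hc).1 (by rw [hd, mul_assoc])⟩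

/-! ### Residue fields of perfect rings. -/

section ResidueField

variable (p : ℕ) [Fact p.Prime] (k : Type u) [Field k] {R : Type u} [CommRing R] [Algebra k R]
  [PerfectRing R p]

theorem perfectRing_residueField [CharP k p] (x : PrimeSpectrum R) :
    PerfectRing x.asIdeal.ResidueField p := by
  have : CharP x.asIdeal.ResidueField p :=
    charP_of_injective_algebraMap (algebraMap k x.asIdeal.ResidueField).injective p
  refine ⟨(frobenius x.asIdeal.ResidueField p).injective, fun y => ?_⟩
  have key : ∀ a : R ⧸ x.asIdeal, ∃ b : x.asIdeal.ResidueField, b ^ p = algebraMap _ _ a := by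
    intro a
    obtain ⟨a, rfl⟩ := Ideal.Quotient.mk_surjective a
    obtain ⟨b, hb⟩ := (PerfectRing.bijective_frobenius (R := R) (p := p)).surjective a
    refine ⟨algebraMap _ _ (Ideal.Quotient.mk x.asIdeal b), ?_⟩
    rw [← map_pow, ← map_pow]
    exact congrArg _ (congrArg _ hb)
  obtain ⟨a, b, -, rfl⟩ := IsFractionRing.div_surjective (R ⧸ x.asIdeal) y
  obtain ⟨a', ha⟩ := key a
  obtain ⟨b', hb⟩ := key b
  exact ⟨a' / b', by simp only [div_pow, ha, hb]⟩

/-- Injectivity of Frobenius makes `R` reduced, so the intersection of its prime ideals is zero. -/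
theorem eq_zero_of_forall_residueField {R : Type u} [CommRing R] [PerfectRing R p] {a : R}
    (h : ∀ x : PrimeSpectrum R, algebraMap R x.asIdeal.ResidueField a = 0) : a = 0 := by
  have hp : p.Prime := Fact.out
  have hred : IsReduced R := (isReduced_iff_pow_one_lt p hp.one_lt).2 fun y hy =>
    (PerfectRing.bijective_frobenius (R := R) (p := p)).injective
      (by simpa only [zero_pow hp.ne_zero] using hy)
  rw [← Ideal.mem_bot, ← Ideal.zero_eq_bot, ← nilradical_eq_zero R, nilradical_eq_sInf,
    Ideal.mem_sInf]
  intro I hI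
  have : I.IsPrime := hI
  exact Ideal.algebraMap_residueField_eq_zero.1 (h ⟨I, hI⟩)

/-- The canonical map `R → κ(x)`. -/
abbrev toResidueField {R : Type u} [CommRing R] [Algebra k R] (x : PrimeSpectrum R) :
    R →ₐ[k] x.asIdeal.ResidueField :=
  IsScalarTower.toAlgHom k R x.asIdeal.ResidueField

end ResidueField

/-! ### Teichmüller lifts, residues and maximal ideals of `𝒪_R`. -/

namespace LocalBase

variable {p : ℕ} [Fact p.Prime] {k : Type u} [Field k] (D D₁ D₂ : LocalBase p k)
  {R S : Type u} [CommRing R] [Algebra k R] [CommRing S] [Algebra k S]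

theorem map_teich (f : R →ₐ[k] S) (a : R) : D.map f (D.teich a) = D.teich (f a) := by
  cases D with
  | equal => exact PowerSeries.map_C _ _
  | mixed O _ _ ϖ irr =>
    refine (WittTensor.map_ofWitt p k O f _).trans ?_
    rw [WittVector.map_teichmuller]; rfl

theorem map_surjective (f : R →ₐ[k] S) (hf : Function.Surjective f) :
    Function.Surjective (D.map f) := by
  cases D with
  | equal => exact PowerSeries.map_surjective f.toRingHom hf
  | mixed O _ _ ϖ irr => exact WittTensor.map_surjective p k O f hf

theorem teich_mul (a b : R) : D.teich (a * b) = D.teich a * D.teich b := by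
  cases D with
  | equal => exact map_mul PowerSeries.C a b
  | mixed O _ _ ϖ irr =>
    exact (congrArg (WittTensor.ofWitt p k O) (map_mul (WittVector.teichmuller p) a b)).trans
      (map_mul (WittTensor.ofWitt p k O) _ _)

theorem teich_one : D.teich (1 : R) = 1 := by
  cases D with
  | equal => exact map_one PowerSeries.C
  | mixed O _ _ ϖ irr =>
    exact (congrArg (WittTensor.ofWitt p k O) (map_one (WittVector.teichmuller p))).trans
      (map_one (WittTensor.ofWitt p k O))

theorem teich_zero : D.teich (0 : R) = 0 := by
  cases D with
  | equal => exact map_zero PowerSeries.C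
  | mixed O _ _ ϖ irr =>
    exact (congrArg (WittTensor.ofWitt p k O) (WittVector.teichmuller_zero p)).trans
      (map_zero (WittTensor.ofWitt p k O))

theorem mk_map_of_mk_eq_digits (f : R →ₐ[k] S) {N : ℕ} {x : D.ring R} {a : Fin N → R}
    (h : (Ideal.Quotient.mk _ x : D.trunc N R) = D.digits N a) :
    (Ideal.Quotient.mk _ (D.map f x) : D.trunc N S) = D.digits N fun i => f (a i) := by
  rw [digits, Ideal.Quotient.mk_eq_mk_iff_sub_mem, Ideal.mem_span_singleton] at h ⊢
  have := map_dvd (D.map f) h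
  simpa only [map_sub, map_sum, map_mul, map_pow, map_unif, map_teich] using this

variable [CharP k p]

variable (R) in
theorem unif_pow_dvd_p {N : ℕ} (h : (N : ℕ∞) ≤ D.valP) : D.unif R ^ N ∣ (p : D.ring R) := by
  cases D with
  | equal =>
    have : ((p : ℕ) : PowerSeries R) = 0 := by
      rw [← map_natCast (PowerSeries.C (R := R)), ← map_natCast (algebraMap k R),
        CharP.cast_eq_zero, map_zero, map_zero]
    exact ⟨0, this.trans (mul_zero _).symm⟩
  | mixed O _ _ ϖ irr =>
    have h1 : ϖ ^ N ∣ (p : O) := by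
      rw [← IsDiscreteValuationRing.addVal_le_iff_dvd, irr.addVal_pow]
      exact h
    have h2 := map_dvd (WittTensor.ofBase p k O : O →+* WittTensor p k O R) h1
    rw [map_pow, map_natCast] at h2
    exact h2

variable [PerfectRing R p] [PerfectRing S p]

theorem exists_teich_add (a b : R) :
    ∃ c, D.teich (a + b) = D.teich a + D.teich b + (p : D.ring R) * c := by
  cases D with
  | equal =>
    exact ⟨0, (map_add PowerSeries.C a b).trans
      ((add_zero _).symm.trans (congrArg _ (mul_zero _).symm))⟩
  | mixed O _ _ ϖ irr =>
    have h : (WittVector.teichmuller p (a + b) - (WittVector.teichmuller p a +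
        WittVector.teichmuller p b)).coeff 0 = 0 := by
      rw [← WittVector.constantCoeff_apply, map_sub, map_add WittVector.constantCoeff]
      simp only [WittVector.constantCoeff_apply, WittVector.teichmuller_coeff_zero, sub_self]
    obtain ⟨c, hc⟩ := Ideal.mem_span_singleton.1 (WittTensor.coeff_zero_mem_span p k h)
    refine ⟨WittTensor.ofWitt p k O c, ?_⟩
    have h1 := congrArg (WittTensor.ofWitt p k O) (eq_add_of_sub_eq' hc)
    rw [map_add (WittTensor.ofWitt p k O), map_add (WittTensor.ofWitt p k O), map_mul, map_natCast] at h1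
    exact h1

variable (R) in
theorem exists_residue : ∃ π : D.ring R →+* R, (∀ a, π (D.teich a) = a) ∧
    ∀ x, π x = 0 ↔ x ∈ Ideal.span {D.unif R} := by
  cases D with
  | equal =>
    refine ⟨PowerSeries.constantCoeff (R := R), fun a => PowerSeries.constantCoeff_C a,
      fun x => ?_⟩
    rw [Ideal.mem_span_singleton]
    exact PowerSeries.X_dvd_iff.symm
  | mixed O _ ram ϖ irr => exact WittTensor.exists_residue p k ram irr

/-- The reduction `𝒪_R → R` modulo the uniformizer. -/
def residue (D : LocalBase p k) (R : Type u) [CommRing R] [Algebra k R] [PerfectRing R p] :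
    D.ring R →+* R :=
  (D.exists_residue R).choose

theorem residue_teich (a : R) : D.residue R (D.teich a) = a :=
  (D.exists_residue R).choose_spec.1 a

theorem residue_eq_zero_iff {x : D.ring R} : D.residue R x = 0 ↔ D.unif R ∣ x :=
  ((D.exists_residue R).choose_spec.2 x).trans Ideal.mem_span_singleton

theorem residue_unif : D.residue R (D.unif R) = 0 :=
  D.residue_eq_zero_iff.2 dvd_rfl

theorem residue_surjective : Function.Surjective (D.residue R) := fun a =>
  ⟨_, D.residue_teich a⟩

theorem exists_eq_teich_add (x : D.ring R) :
    ∃ y, x = D.teich (D.residue R x) + D.unif R * y := by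
  obtain ⟨y, hy⟩ := D.residue_eq_zero_iff.1
    (show D.residue R (x - D.teich (D.residue R x)) = 0 by
      rw [map_sub, residue_teich, sub_self])
  exact ⟨y, eq_add_of_sub_eq' hy⟩

theorem residue_map (f : R →ₐ[k] S) (x : D.ring R) :
    D.residue S (D.map f x) = f (D.residue R x) := by
  obtain ⟨y, hy⟩ := D.exists_eq_teich_add x
  conv_lhs => rw [hy]
  rw [map_add, map_mul, map_unif, map_add, map_mul, residue_unif, zero_mul, add_zero, map_teich,
    residue_teich]

theorem unif_mem_of_isMaximal {M : Ideal (D.ring R)} (hM : M.IsMaximal) : D.unif R ∈ M := by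
  cases D with
  | equal =>
    have h : (PowerSeries.X : PowerSeries R) ∈ (⊥ : Ideal (PowerSeries R)).jacobson := by
      rw [Ideal.mem_jacobson_bot]
      intro y
      rw [PowerSeries.isUnit_iff_constantCoeff]
      simp
    exact (sInf_le ⟨bot_le, hM⟩ : (⊥ : Ideal (PowerSeries R)).jacobson ≤ M) h
  | mixed O inj _ ϖ irr => exact WittTensor.ofBase_mem_of_isMaximal p k inj irr hM

/-- The uniformizer lies in the Jacobson radical, so any entrywise lift of an invertible matrix has
unit determinant. For `N = 0` the ideal is everything and the target is trivial, which is why that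
case is separate. -/
theorem red_surjective (n N : ℕ) : Function.Surjective (D.red n N R) := by
  intro G
  rcases Nat.eq_zero_or_pos N with rfl | hN
  · have : Subsingleton (D.trunc 0 R) :=
      Ideal.Quotient.subsingleton_iff.2 (by rw [pow_zero, Ideal.span_singleton_one])
    exact ⟨1, Units.ext (Matrix.ext fun _ _ => Subsingleton.elim _ _)⟩
  have hle : Ideal.span {D.unif R ^ N} ≤ (⊥ : Ideal (D.ring R)).jacobson := by
    rw [Ideal.span_singleton_le_iff_mem, Ideal.jacobson, Ideal.mem_sInf]
    rintro M ⟨-, hM⟩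
    exact M.pow_mem_of_mem (D.unif_mem_of_isMaximal hM) N hN
  have := isLocalHom_of_le_jacobson_bot _ hle
  choose g hg using fun i j => Ideal.Quotient.mk_surjective
    ((G : Matrix (Fin n) (Fin n) (D.trunc N R)) i j)
  have hmap : (Ideal.Quotient.mk (Ideal.span {D.unif R ^ N})).mapMatrix (Matrix.of g) =
      (G : Matrix (Fin n) (Fin n) (D.trunc N R)) :=
    Matrix.ext hg
  have hdet : IsUnit (Matrix.of g).det := by
    refine isUnit_of_map_unit (Ideal.Quotient.mk (Ideal.span {D.unif R ^ N})) _ ?_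
    rw [RingHom.map_det, hmap]
    exact (Matrix.isUnit_iff_isUnit_det _).1 G.isUnit
  exact ⟨((Matrix.isUnit_iff_isUnit_det _).2 hdet).unit, Units.ext hmap⟩

/-! ### Digits -/

theorem exists_eq_sum_teich (N : ℕ) (x : D.ring R) : ∃ (a : Fin N → R) (y : D.ring R),
    x = ∑ i, D.teich (a i) * D.unif R ^ (i : ℕ) + D.unif R ^ N * y := by
  induction N with
  | zero => exact ⟨Fin.elim0, x, by simp⟩
  | succ N ih =>
    obtain ⟨a, y, h⟩ := ih
    obtain ⟨z, hz⟩ := D.exists_eq_teich_add y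
    refine ⟨Fin.snoc a (D.residue R y), z, ?_⟩
    rw [Fin.sum_univ_castSucc]
    simp only [Fin.snoc_castSucc, Fin.snoc_last, Fin.val_castSucc, Fin.val_last]
    rw [h]
    conv_lhs => rw [hz]
    ring

/-- The residue map reads off the lowest digit; once it is zero, one factor `ϖ` is cancelled and the
induction continues. -/
theorem eq_zero_of_sum_teich [IsAlgClosed k] (N : ℕ) (a : Fin N → R)
    (h : D.unif R ^ N ∣ ∑ i, D.teich (a i) * D.unif R ^ (i : ℕ)) : a = 0 := by
  induction N with
  | zero => exact Subsingleton.elim _ _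
  | succ N ih =>
    have h1 : ∑ i : Fin (N + 1), D.teich (a i) * D.unif R ^ (i : ℕ) = D.teich (a 0) +
        D.unif R * ∑ i : Fin N, D.teich (a i.succ) * D.unif R ^ (i : ℕ) := by
      rw [Fin.sum_univ_succ, Finset.mul_sum]
      simp only [Fin.val_zero, pow_zero, mul_one, Fin.val_succ, pow_succ]
      congr 1
      exact Finset.sum_congr rfl fun i _ => by ring
    rw [h1] at h
    have h0 : a 0 = 0 := by
      have h2 := D.residue_eq_zero_iff.2 ((dvd_pow_self _ N.succ_ne_zero).trans h)
      rwa [map_add, map_mul, residue_unif, zero_mul, add_zero, residue_teich] at h2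
    rw [h0, teich_zero, zero_add, pow_succ'] at h
    have h3 := ih (fun i => a i.succ) (dvd_of_mul_dvd_mul_left_of_mem_nonZeroDivisors
      D.unif_mem_nonZeroDivisors h)
    funext i
    exact Fin.cases h0 (fun j => congrFun h3 j) i

variable {N : ℕ}

/-- For `N ≤ v(p)`, the ring homomorphism `R → 𝒪_R/ϖᴺ`, `a ↦ [a]`. -/
def teichHom (R : Type u) [CommRing R] [Algebra k R] [PerfectRing R p]
    (h : (N : ℕ∞) ≤ D.valP) : R →+* D.trunc N R where
  toFun a := Ideal.Quotient.mk _ (D.teich a)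
  map_one' := by rw [teich_one, map_one]
  map_mul' a b := by rw [teich_mul, map_mul]
  map_zero' := by rw [teich_zero, map_zero]
  map_add' a b := by
    obtain ⟨c, hc⟩ := D.exists_teich_add a b
    rw [hc, ← map_add, Ideal.Quotient.mk_eq_mk_iff_sub_mem, add_sub_cancel_left,
      Ideal.mem_span_singleton]
    -- The bound `N ≤ v(p)` enters here: the failure of additivity is a multiple of `p`, hence of `ϖ
    -- ^ N`.
    exact (D.unif_pow_dvd_p R h).mul_right c

/-- For `N ≤ v(p)`, the ring homomorphism `R[X] → 𝒪_R/ϖᴺ` with `a ↦ [a]` and `X ↦ ϖ`. -/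
def polyHom (R : Type u) [CommRing R] [Algebra k R] [PerfectRing R p]
    (h : (N : ℕ∞) ≤ D.valP) : Polynomial R →+* D.trunc N R :=
  Polynomial.eval₂RingHom (D.teichHom R h) (Ideal.Quotient.mk _ (D.unif R))

theorem digits_eq (h : (N : ℕ∞) ≤ D.valP) (a : Fin N → R) : D.digits N a =
    ∑ i, D.teichHom R h (a i) * Ideal.Quotient.mk _ (D.unif R) ^ (i : ℕ) := by
  rw [digits, map_sum]
  simp only [map_mul, map_pow]
  rfl

theorem polyHom_eq_digits (h : (N : ℕ∞) ≤ D.valP) (P : Polynomial R) :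
    D.polyHom R h P = D.digits N fun i => P.coeff i := by
  -- The summation range is padded to `N + (P.natDegree + 1)` so that it splits at `N` for every
  -- degree; the terms from `N` on vanish.
  rw [D.digits_eq h, polyHom, Polynomial.coe_eval₂RingHom,
    Polynomial.eval₂_eq_sum_range' _ (show P.natDegree < N + (P.natDegree + 1) by lia),
    Finset.sum_range_add, Finset.sum_range, add_eq_left]
  refine Finset.sum_eq_zero fun i _ => ?_
  rw [pow_add, ← map_pow, Ideal.Quotient.eq_zero_iff_mem.2 (Ideal.mem_span_singleton_self _),
    zero_mul, mul_zero]

theorem digits_surjective : Function.Surjective (D.digits N : (Fin N → R) → D.trunc N R) := by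
  intro x
  obtain ⟨x, rfl⟩ := Ideal.Quotient.mk_surjective x
  obtain ⟨a, y, h⟩ := D.exists_eq_sum_teich N x
  refine ⟨a, ?_⟩
  rw [digits, Ideal.Quotient.mk_eq_mk_iff_sub_mem, h, sub_add_cancel_left, neg_mem_iff]
  exact Ideal.mul_mem_right _ _ (Ideal.mem_span_singleton_self _)

theorem digits_eq_zero_iff [IsAlgClosed k] {a : Fin N → R} : D.digits N a = 0 ↔ a = 0 := by
  refine ⟨fun h => D.eq_zero_of_sum_teich N a
    (Ideal.mem_span_singleton.1 (Ideal.Quotient.eq_zero_iff_mem.1 h)), ?_⟩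
  rintro rfl
  simp [digits, teich_zero]

/-- With `N ≤ v(p)` the digit map is additive, so injectivity reduces to its kernel. -/
theorem digits_injective [IsAlgClosed k] (h : (N : ℕ∞) ≤ D.valP) :
    Function.Injective (D.digits N : (Fin N → R) → D.trunc N R) := by
  intro a b hab
  have h1 : D.digits N (a - b) = 0 := by
    rw [← sub_eq_zero.2 hab]
    simp only [D.digits_eq h, Pi.sub_apply, map_sub, sub_mul, Finset.sum_sub_distrib]
  exact sub_eq_zero.1 (D.digits_eq_zero_iff.1 h1)

theorem exists_polyHom_eq_digits (h : (N : ℕ∞) ≤ D.valP) (a : Fin N → R) :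
    D.polyHom R h (∑ i, Polynomial.C (a i) * Polynomial.X ^ (i : ℕ)) = D.digits N a := by
  rw [D.digits_eq h, map_sum]
  simp [polyHom]

theorem polyHom_surjective (h : (N : ℕ∞) ≤ D.valP) : Function.Surjective (D.polyHom R h) := by
  intro x
  obtain ⟨a, rfl⟩ := D.digits_surjective x
  exact ⟨_, D.exists_polyHom_eq_digits h a⟩

theorem ker_polyHom_eq [IsAlgClosed k] (h₁ : (N : ℕ∞) ≤ D₁.valP) (h₂ : (N : ℕ∞) ≤ D₂.valP) :
    RingHom.ker (D₁.polyHom R h₁) = RingHom.ker (D₂.polyHom R h₂) := by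
  ext P
  rw [RingHom.mem_ker, RingHom.mem_ker, polyHom_eq_digits, polyHom_eq_digits, digits_eq_zero_iff,
    digits_eq_zero_iff]

variable {D₁ D₂}

/-- The isomorphism `𝒪_{1,R}/ϖ₁ᴺ ≅ 𝒪_{2,R}/ϖ₂ᴺ`, `∑ [aᵢ] ϖ₁ⁱ ↦ ∑ [aᵢ] ϖ₂ⁱ`. -/
def truncEquiv [IsAlgClosed k] (h₁ : (N : ℕ∞) ≤ D₁.valP) (h₂ : (N : ℕ∞) ≤ D₂.valP) (R : Type u)
    [CommRing R] [Algebra k R] [PerfectRing R p] : D₁.trunc N R ≃+* D₂.trunc N R :=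
  (RingHom.quotientKerEquivOfSurjective (D₁.polyHom_surjective h₁)).symm.trans
    ((Ideal.quotEquivOfEq (ker_polyHom_eq D₁ D₂ h₁ h₂)).trans
      (RingHom.quotientKerEquivOfSurjective (D₂.polyHom_surjective h₂)))

variable [IsAlgClosed k] (h₁ : (N : ℕ∞) ≤ D₁.valP) (h₂ : (N : ℕ∞) ≤ D₂.valP)

theorem truncEquiv_polyHom (P : Polynomial R) :
    truncEquiv h₁ h₂ R (D₁.polyHom R h₁ P) = D₂.polyHom R h₂ P := by
  have h : (RingHom.quotientKerEquivOfSurjective (D₁.polyHom_surjective h₁)).symm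
      (D₁.polyHom R h₁ P) = Ideal.Quotient.mk _ P :=
    (RingEquiv.symm_apply_eq _).2 (RingHom.quotientKerEquivOfSurjective_apply_mk _ P).symm
  rw [truncEquiv, RingEquiv.trans_apply, h, RingEquiv.trans_apply, Ideal.quotEquivOfEq_mk,
    RingHom.quotientKerEquivOfSurjective_apply_mk]

theorem truncEquiv_digits (a : Fin N → R) :
    truncEquiv h₁ h₂ R (D₁.digits N a) = D₂.digits N a := by
  rw [← D₁.exists_polyHom_eq_digits h₁, truncEquiv_polyHom, exists_polyHom_eq_digits]

theorem truncEquiv_unif : truncEquiv h₁ h₂ R (Ideal.Quotient.mk _ (D₁.unif R)) =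
    Ideal.Quotient.mk _ (D₂.unif R) := by
  have := truncEquiv_polyHom h₁ h₂ (R := R) Polynomial.X
  simpa only [polyHom, Polynomial.coe_eval₂RingHom, Polynomial.eval₂_X] using this

theorem truncEquiv_symm : (truncEquiv h₁ h₂ R).symm = truncEquiv h₂ h₁ R := by
  ext x
  obtain ⟨a, rfl⟩ := D₂.digits_surjective x
  rw [truncEquiv_digits, RingEquiv.symm_apply_eq, truncEquiv_digits]

theorem truncEquiv_map (f : R →ₐ[k] S) (a : D₁.ring R) (b : D₂.ring R)
    (hab : truncEquiv h₁ h₂ R (Ideal.Quotient.mk _ a) = Ideal.Quotient.mk _ b) :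
    truncEquiv h₁ h₂ S (Ideal.Quotient.mk _ (D₁.map f a)) = Ideal.Quotient.mk _ (D₂.map f b) := by
  obtain ⟨c, hc⟩ := D₁.digits_surjective (Ideal.Quotient.mk _ a : D₁.trunc N R)
  rw [← hc, truncEquiv_digits] at hab
  rw [D₁.mk_map_of_mk_eq_digits f hc.symm, D₂.mk_map_of_mk_eq_digits f hab.symm, truncEquiv_digits]

/-! ### Integrality at the points of `Spec R` -/

/-- The residue of `a` vanishes at every point of `Spec R`, hence is zero. So `a` is divisible by
`ϖ`, and the quotient satisfies the hypothesis for the next lower power. -/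
theorem unif_pow_dvd_of_forall (D : LocalBase p k) (m : ℕ) (a : D.ring R)
    (h : ∀ x : PrimeSpectrum R, D.unif _ ^ m ∣ D.map (toResidueField k x) a) :
    D.unif R ^ m ∣ a := by
  induction m generalizing a with
  | zero => simp
  | succ m ih =>
    have h0 : D.residue R a = 0 := by
      refine eq_zero_of_forall_residueField p fun x => ?_
      have := perfectRing_residueField p k x
      refine (D.residue_map (toResidueField k x) a).symm.trans (D.residue_eq_zero_iff.2 ?_)
      exact (dvd_pow_self _ m.succ_ne_zero).trans (h x)
    obtain ⟨b, rfl⟩ := D.residue_eq_zero_iff.1 h0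
    rw [pow_succ']
    refine mul_dvd_mul_left _ (ih b fun x => ?_)
    have := perfectRing_residueField p k x
    have hx := h x
    rw [map_mul, map_unif, pow_succ'] at hx
    exact dvd_of_mul_dvd_mul_left_of_mem_nonZeroDivisors D.unif_mem_nonZeroDivisors hx

theorem mem_range_of_forall (D : LocalBase p k) (y : Localization.Away (D.unif R))
    (h : ∀ x : PrimeSpectrum R, locMap (D.map (toResidueField k x)) (D.map_unif _) y ∈
      (algebraMap (D.ring x.asIdeal.ResidueField) (Localization.Away (D.unif _))).range) :
    y ∈ (algebraMap (D.ring R) (Localization.Away (D.unif R))).range := by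
  obtain ⟨⟨_, m, rfl⟩, a, ha⟩ :=
    IsLocalization.exists_integer_multiple (Submonoid.powers (D.unif R)) y
  change algebraMap _ _ a = D.unif R ^ m • y at ha
  obtain ⟨b, rfl⟩ := D.unif_pow_dvd_of_forall m a fun x => by
    have := perfectRing_residueField p k x
    obtain ⟨c, hc⟩ := h x
    refine ⟨c, IsLocalization.injective (Localization.Away (D.unif x.asIdeal.ResidueField))
      (Submonoid.powers_le.2 D.unif_mem_nonZeroDivisors) ?_⟩
    rw [← locMap_algebraMap (D.map (toResidueField k x)) (D.map_unif _), ha, locMap_smul, map_pow,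
      map_unif, ← hc, map_mul, Algebra.smul_def]
  refine ⟨b, unif_pow_smul_injective (D.unif R) m ?_⟩
  rw [← ha, map_mul, Algebra.smul_def]

end LocalBase

/-- The cocharacter `(N, 0, …, 0)`. -/
abbrev firstWeight (n N : ℕ) : Fin n → ℤ := fun i => if (i : ℕ) = 0 then (N : ℤ) else 0

theorem sum_firstWeight {n N : ℕ} (s : Finset (Fin n)) (i : Fin n) (hi : (i : ℕ) = 0)
    (his : i ∈ s) : ∑ j ∈ s, firstWeight n N j = N := by
  rw [Finset.sum_eq_single_of_mem i his fun j _ hj => if_neg fun h => hj (Fin.ext (h.trans hi.symm))]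
  exact if_pos hi

/-- If `m i < 0`, all entries from `i` on are negative, while dominance bounds the sum of the
earlier ones by `N`; then the total is less than `N`. Nonnegative entries with sum `N` are at most
`N`. -/
theorem DomLE.nonneg_and_le {n N : ℕ} {m : Fin n → ℤ} (hm : Antitone m)
    (h : DomLE m (firstWeight n N)) : (∀ i, 0 ≤ m i) ∧ ∀ i, m i ≤ N := by
  -- The index serves only to guarantee `0 < n`; for `n = 0` the sum is `0`.
  have hsum : ∀ i : Fin n, ∑ j, m j = N := fun i => h.2.trans
    (sum_firstWeight _ ⟨0, i.pos⟩ rfl (Finset.mem_univ _))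
  have h0 : ∀ i, 0 ≤ m i := by
    intro i
    by_contra! hi
    have hIci : ∑ j ∈ Finset.Ici i, m j ≤ (Finset.Ici i).card • m i :=
      Finset.sum_le_card_nsmul _ _ _ fun j hj => hm (Finset.mem_Ici.1 hj)
    have hcard : 0 < (Finset.Ici i).card := Finset.card_pos.2 ⟨i, Finset.mem_Ici.2 le_rfl⟩
    have hneg : (Finset.Ici i).card • m i < 0 := by
      rw [nsmul_eq_mul]
      exact mul_neg_of_pos_of_neg (by exact_mod_cast hcard) hi
    have hIio : ∑ j ∈ Finset.Iio i, m j ≤ N := by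
      rcases Nat.eq_zero_or_pos (i : ℕ) with hz | hz
      · have : Finset.Iio i = ∅ := by
          ext j
          simp [Fin.lt_def, hz]
        simp [this]
      · let j : Fin n := ⟨i - 1, by lia⟩
        have : Finset.Iio i = Finset.Iic j := by
          ext l
          simp only [Finset.mem_Iio, Finset.mem_Iic, Fin.lt_def, Fin.le_def, j]
          lia
        rw [this]
        refine (h.1 j).trans (sum_firstWeight _ ⟨0, i.pos⟩ rfl ?_).le
        simp [Fin.le_def]
    have hsplit : ∑ j ∈ Finset.Iio i, m j + ∑ j ∈ Finset.Ici i, m j = ∑ j, m j := by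
      rw [← Finset.sum_union (Finset.disjoint_left.2 fun j hj hj' =>
        absurd (Finset.mem_Iio.1 hj) (not_lt.2 (Finset.mem_Ici.1 hj')))]
      congr 1
      ext j
      simp [lt_or_ge]
    rw [hsum i] at hsplit
    lia
  exact ⟨h0, fun i => (Finset.single_le_sum (fun j _ => h0 j)
    (Finset.mem_univ i)).trans (hsum i).le⟩

/-! ### Points of the Schubert variety and their transport. -/

section Points

variable {p : ℕ} [Fact p.Prime] {k : Type u} [Field k] [CharP k p] [IsAlgClosed k]
  {D D₁ D₂ : LocalBase p k} {n N : ℕ}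
  {R : Type u} [CommRing R] [Algebra k R] [PerfectRing R p]

/-- The points of `Gr_{≤ (N, 0, …, 0)}` lie between `ϖᴺ𝒪_Rⁿ` and `𝒪_Rⁿ`. -/
theorem IsLattice.isBetween_of_invLE {E : Submodule (D.ring R) (Amb (D.unif R) n)}
    (hE : IsLattice (D.unif R) n E) (h : InvLE D n (firstWeight n N) E) : IsBetween N E := by
  have hx : ∀ x : PrimeSpectrum R, IsBetween N
      (AffGr.baseChange (D.map (toResidueField k x)) (D.map_unif _) E) := by
    intro x
    obtain ⟨m, hm, hE⟩ := h x
    obtain ⟨h0, hN⟩ := hm.nonneg_and_le hE.1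
    exact hE.isBetween h0 hN
  constructor
  · intro v
    refine hE.mem_of_forall_baseChange (fun x => D.map (toResidueField k x))
      (fun x => D.map_unif _) (fun y hy => D.mem_range_of_forall y hy) fun x => ?_
    change bcMap (D.map (toResidueField k x)) (D.map_unif _) (D.unif R ^ N • std (D.unif R) n v) ∈ _
    rw [map_smulₛₗ, map_pow, LocalBase.map_unif, bcMap_std]
    exact (hx x).1 _
  · intro v hv
    have key : ∀ i, v i ∈ (algebraMap (D.ring R) (Localization.Away (D.unif R))).range := fun i =>
      D.mem_range_of_forall _ fun x => by
        obtain ⟨w, hw⟩ := (hx x).2 (Submodule.subset_span ⟨v, hv, rfl⟩)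
        exact ⟨w i, congrFun hw i⟩
    choose w hw using key
    exact ⟨w, funext hw⟩

variable (h₁ : (N : ℕ∞) ≤ D₁.valP) (h₂ : (N : ℕ∞) ≤ D₂.valP)

theorem baseChange_transfer {S : Type u} [CommRing S] [Algebra k S] [PerfectRing S p] (f : R →ₐ[k] S)
    {E : Submodule (D₁.ring R) (Amb (D₁.unif R) n)} (hE : IsBetween N E) :
    AffGr.baseChange (D₂.map f) (D₂.map_unif f) (transfer (LocalBase.truncEquiv h₁ h₂ R) E) =
      transfer (LocalBase.truncEquiv h₁ h₂ S) (AffGr.baseChange (D₁.map f) (D₁.map_unif f) E) :=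
  (transfer_baseChange D₁.unif_mem_nonZeroDivisors D₁.unif_mem_nonZeroDivisors _ _ _ _
    (LocalBase.truncEquiv_map h₁ h₂ f) hE.2).symm

theorem InvLE.transfer {E : Submodule (D₁.ring R) (Amb (D₁.unif R) n)} (hE : IsBetween N E)
    (h : InvLE D₁ n (firstWeight n N) E) :
    InvLE D₂ n (firstWeight n N) (AffGr.transfer (LocalBase.truncEquiv h₁ h₂ R) E) := by
  intro x
  have := perfectRing_residueField p k x
  obtain ⟨m, hm, hx⟩ := h x
  obtain ⟨h0, hN⟩ := hm.nonneg_and_le hx.1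
  refine ⟨m, hm, ?_⟩
  rw [baseChange_transfer h₁ h₂ _ hE]
  exact hx.transfer D₁.unif_mem_nonZeroDivisors (LocalBase.truncEquiv_unif h₁ h₂)
    (D₂.red_surjective n N) h0 hN

/-- The transport along `θ` of a point of `Gr_{≤ (N, 0, …, 0)}` is a lattice. -/
theorem IsLattice.transfer {E : Submodule (D₁.ring R) (Amb (D₁.unif R) n)}
    (hE : IsLattice (D₁.unif R) n E) (h : InvLE D₁ n (firstWeight n N) E) :
    IsLattice (D₂.unif R) n (AffGr.transfer (LocalBase.truncEquiv h₁ h₂ R) E) := by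
  have hb := hE.isBetween_of_invLE h
  have hb' := isBetween_transfer (LocalBase.truncEquiv h₁ h₂ R) E
  refine hb'.isLattice D₂.unif_mem_nonZeroDivisors
    (transfer_fg D₁.unif_mem_nonZeroDivisors hb.2 ((Module.Finite.iff_fg).1 hE.finite))
    fun P hP => ?_
  -- As `P` contains the uniformizer, it is the preimage of a maximal ideal of `R`. At that point `R
  -- → κ(x)` is surjective, which makes the base change to the fibre surjective as well.
  have hcomap : (P.map (D₂.residue R)).comap (D₂.residue R) = P := by
    rw [Ideal.comap_map_of_surjective _ D₂.residue_surjective, sup_eq_left]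
    intro a ha
    obtain ⟨b, rfl⟩ := D₂.residue_eq_zero_iff.1 ha
    exact P.mul_mem_right _ (D₂.unif_mem_of_isMaximal hP)
  have hmax : (P.map (D₂.residue R)).IsMaximal :=
    (Ideal.map_eq_top_or_isMaximal_of_surjective _ D₂.residue_surjective hP).resolve_left
      fun htop => hP.ne_top (by rw [← hcomap, htop, Ideal.comap_top])
  let x : PrimeSpectrum R := ⟨P.map (D₂.residue R), hmax.isPrime⟩
  have : x.asIdeal.IsMaximal := hmax
  have := perfectRing_residueField p k x
  have hsurj : Function.Surjective (toResidueField k x) :=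
    Ideal.algebraMap_residueField_surjective x.asIdeal
  -- The relative position of the transported fibre supplies its `n` generators; only their number
  -- matters.
  obtain ⟨m, -, -, f, hf⟩ := h.transfer h₁ h₂ hb x
  refine hb'.exists_generators_of_baseChange D₂.unif_mem_nonZeroDivisors
    (D₂.map (toResidueField k x)) (D₂.map_unif _) (D₂.map_surjective _ hsurj) (fun v hv hv0 => ?_)
    (fun a ha => ?_) hf
  · exact transfer_ker_smul D₁.unif_mem_nonZeroDivisors D₂.unif_mem_nonZeroDivisors
      D₂.unif_mem_nonZeroDivisors (D₁.map_unif (toResidueField k x)) (D₂.map_unif _)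
      (D₁.map_surjective _ hsurj) (D₂.map_surjective _ hsurj)
      (LocalBase.truncEquiv_map h₁ h₂ (toResidueField k x)) hb
      (fun w hw hw0 => hE.std_mem_ker_smul D₁.unif_mem_nonZeroDivisors
        (D₁.map (toResidueField k x)) (D₁.map_unif _) hw hw0) hv hv0
  · rw [← hcomap, Ideal.mem_comap]
    have ha' := congrArg (D₂.residue x.asIdeal.ResidueField) (show D₂.map _ a = 0 from ha)
    rw [map_zero, LocalBase.residue_map] at ha'
    exact (Ideal.algebraMap_residueField_eq_zero (I := x.asIdeal)).1 ha'

end Points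

/-! ### The isomorphism of functors, its uniqueness and equivariance. -/

section Functors

variable {p : ℕ} [Fact p.Prime] {k : Type u} [Field k] [CharP k p] [IsAlgClosed k]
  {D D₁ D₂ : LocalBase p k} {n N : ℕ}

instance (R : PerfAlg p k) : PerfectRing R.obj p := R.property

theorem GrBar.isBetween {R : PerfAlg p k} (E : (GrBar D n N).obj R) :
    IsBetween N (GrBar.lattice E) :=
  E.1.2.isBetween_of_invLE E.2

theorem GrBar.ext_lattice {R : PerfAlg p k} {E E' : (GrBar D n N).obj R}
    (h : GrBar.lattice E = GrBar.lattice E') : E = E' :=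
  Subtype.ext (Subtype.ext h)

variable (n) (h₁ : (N : ℕ∞) ≤ D₁.valP) (h₂ : (N : ℕ∞) ≤ D₂.valP)

/-- The transport of the points of `Gr_{≤ (N, 0, …, 0)}` along `θ`. -/
def GrBar.transfer {R : PerfAlg p k} (E : (GrBar D₁ n N).obj R) : (GrBar D₂ n N).obj R :=
  ⟨⟨AffGr.transfer (LocalBase.truncEquiv h₁ h₂ R.obj) (GrBar.lattice E),
    E.1.2.transfer h₁ h₂ E.2⟩, InvLE.transfer h₁ h₂ (GrBar.isBetween E) E.2⟩

theorem GrBar.lattice_transfer {R : PerfAlg p k} (E : (GrBar D₁ n N).obj R) :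
    GrBar.lattice (GrBar.transfer n h₁ h₂ E) =
      AffGr.transfer (LocalBase.truncEquiv h₁ h₂ R.obj) (GrBar.lattice E) := rfl

theorem GrBar.transfer_transfer {R : PerfAlg p k} (E : (GrBar D₁ n N).obj R) :
    GrBar.transfer n h₂ h₁ (GrBar.transfer n h₁ h₂ E) = E := by
  apply GrBar.ext_lattice
  rw [GrBar.lattice_transfer, GrBar.lattice_transfer, ← LocalBase.truncEquiv_symm h₁ h₂]
  exact transfer_symm_transfer D₁.unif_mem_nonZeroDivisors D₂.unif_mem_nonZeroDivisors
    (GrBar.isBetween E)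

theorem GrBar.transfer_map {R S : PerfAlg p k} (f : R ⟶ S) (E : (GrBar D₁ n N).obj R) :
    GrBar.transfer n h₁ h₂ ((GrBar D₁ n N).map f E) =
      (GrBar D₂ n N).map f (GrBar.transfer n h₁ h₂ E) :=
  GrBar.ext_lattice (baseChange_transfer h₁ h₂ f.hom.hom (GrBar.isBetween E)).symm

/-- The isomorphism `Gr_{≤ (N, 0, …, 0)} ≅ Gr_{≤ (N, 0, …, 0)}` coming from `θ`. -/
def GrBar.iso : GrBar D₁ n N ≅ GrBar D₂ n N :=
  NatIso.ofComponents
    (fun _ => Equiv.toIso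
      { toFun := fun E => GrBar.transfer n h₁ h₂ E
        invFun := fun E => GrBar.transfer n h₂ h₁ E
        left_inv := GrBar.transfer_transfer n h₁ h₂
        right_inv := GrBar.transfer_transfer n h₂ h₁ })
    fun f => ConcreteCategory.hom_ext _ _ fun E => GrBar.transfer_map n h₁ h₂ f E

theorem comesFrom_iso :
    ComesFrom (fun R => LocalBase.truncEquiv h₁ h₂ R.obj) (GrBar.iso n h₁ h₂) :=
  fun _ E => ⟨GrBar.isBetween E, GrBar.isBetween _,
    fun v => mem_reduction_transfer_iff D₂.unif_mem_nonZeroDivisors v⟩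

theorem ComesFrom.eq_iso {α : GrBar D₁ n N ≅ GrBar D₂ n N}
    (h : ComesFrom (fun R => LocalBase.truncEquiv h₁ h₂ R.obj) α) : α = GrBar.iso n h₁ h₂ := by
  apply Iso.ext
  apply NatTrans.ext
  funext R
  refine ConcreteCategory.hom_ext _ _ fun E => GrBar.ext_lattice ?_
  exact (h R E).2.1.eq_transfer D₂.unif_mem_nonZeroDivisors (h R E).2.2

variable (D N)

theorem GrBar.smul_eq_of_red_eq {R : PerfAlg p k} {g h : GL (Fin n) (D.ring R.obj)}
    (hgh : D.red n N R.obj g = D.red n N R.obj h) (E : (GrBar D n N).obj R) : g • E = h • E :=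
  GrBar.ext_lattice (glAct_congr D.unif_mem_nonZeroDivisors (GrBar.isBetween E)
    (GrBar.isBetween (g • E)) hgh)

/-- The action of `LᴺGLₙ` on `Gr_{≤ (N, 0, …, 0)}`. -/
def inducedAction (R : PerfAlg p k) :
    GL (Fin n) (D.trunc N R.obj) →* Equiv.Perm ((GrBar D n N).obj R) :=
  (D.red n N R.obj).liftOfSurjective (D.red_surjective n N)
    ⟨MulAction.toPermHom _ _, fun g hg => Equiv.ext fun E => by
      have := GrBar.smul_eq_of_red_eq D n N (hg.trans (map_one (D.red n N R.obj)).symm) E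
      rwa [one_smul] at this⟩

theorem isInducedAction_inducedAction : IsInducedAction D n N (inducedAction D n N) := by
  intro R
  refine ⟨D.red_surjective n N, fun g E => ?_⟩
  rw [inducedAction]
  exact Equiv.congr_fun (MonoidHom.liftOfRightInverse_comp_apply _ _ _ _ g) E

variable {D N}

/-- Lift `g` and its image under `θ` to the two groups `L⁺GLₙ(R)`; the lifts correspond modulo `ϖ ^
N`, so `transfer_glAct` applies. -/
theorem GrBar.transfer_inducedAction {R : PerfAlg p k} (g : GL (Fin n) (D₁.trunc N R.obj))
    (E : (GrBar D₁ n N).obj R) :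
    GrBar.transfer n h₁ h₂ (inducedAction D₁ n N R g E) =
      inducedAction D₂ n N R (Matrix.GeneralLinearGroup.map
        (LocalBase.truncEquiv h₁ h₂ R.obj).toRingHom g) (GrBar.transfer n h₁ h₂ E) := by
  obtain ⟨g₁, rfl⟩ := D₁.red_surjective n N g
  obtain ⟨g₂, hg₂⟩ := D₂.red_surjective n N (Matrix.GeneralLinearGroup.map
    (LocalBase.truncEquiv h₁ h₂ R.obj).toRingHom (D₁.red n N R.obj g₁))
  rw [← hg₂, (isInducedAction_inducedAction D₁ n N R).2,
    (isInducedAction_inducedAction D₂ n N R).2]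
  exact GrBar.ext_lattice (transfer_glAct hg₂.symm)

end Functors

end AffGr

end

theorem mainTheorem4 (p : ℕ) [Fact p.Prime] (k : Type u) [Field k] [CharP k p] [IsAlgClosed k]
    (D₁ D₂ : AffGr.LocalBase p k) (n N : ℕ)
    (h₁ : (N : ℕ∞) ≤ D₁.valP) (h₂ : (N : ℕ∞) ≤ D₂.valP) :
    ∃ θ : ∀ R : AffGr.PerfAlg p k, D₁.trunc N R.obj ≃+* D₂.trunc N R.obj,
      -- `θ` is the ring isomorphism `∑ [aᵢ] ϖ₁ⁱ ↦ ∑ [aᵢ] ϖ₂ⁱ`, and it is natural in `R`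
      (∀ R : AffGr.PerfAlg p k,
        Function.Bijective (D₁.digits N : (Fin N → R.obj) → D₁.trunc N R.obj) ∧
        Function.Bijective (D₂.digits N : (Fin N → R.obj) → D₂.trunc N R.obj) ∧
        ∀ a : Fin N → R.obj, θ R (D₁.digits N a) = D₂.digits N a) ∧
      (∀ (R S : AffGr.PerfAlg p k) (f : R ⟶ S) (a : D₁.ring R.obj) (b : D₂.ring R.obj),
        θ R (Ideal.Quotient.mk _ a) = Ideal.Quotient.mk _ b →
        θ S (Ideal.Quotient.mk _ (D₁.map f.hom.hom a)) =
          Ideal.Quotient.mk _ (D₂.map f.hom.hom b)) ∧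
      -- there is a unique isomorphism of the Schubert varieties coming from `θ`
      ∃ α : AffGr.GrBar D₁ n N ≅ AffGr.GrBar D₂ n N,
        AffGr.ComesFrom θ α ∧ (∀ α', AffGr.ComesFrom θ α' → α' = α) ∧
        -- the groups `LᴺGLₙ` act, and `α` is equivariant through `θ`
        ∃ ρ₁ ρ₂, AffGr.IsInducedAction D₁ n N ρ₁ ∧ AffGr.IsInducedAction D₂ n N ρ₂ ∧
          ∀ (R : AffGr.PerfAlg p k) (g : GL (Fin n) (D₁.trunc N R.obj))
            (E : (AffGr.GrBar D₁ n N).obj R),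
            α.hom.app R (ρ₁ R g E) =
              ρ₂ R (Matrix.GeneralLinearGroup.map (θ R).toRingHom g) (α.hom.app R E) := by
  refine ⟨fun R => AffGr.LocalBase.truncEquiv h₁ h₂ R.obj, fun R => ⟨⟨D₁.digits_injective h₁,
    D₁.digits_surjective⟩, ⟨D₂.digits_injective h₂, D₂.digits_surjective⟩,
    AffGr.LocalBase.truncEquiv_digits h₁ h₂⟩,
    fun R S f => AffGr.LocalBase.truncEquiv_map h₁ h₂ f.hom.hom, AffGr.GrBar.iso n h₁ h₂,
    AffGr.comesFrom_iso n h₁ h₂, fun α' h => h.eq_iso n h₁ h₂,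
    AffGr.inducedAction D₁ n N, AffGr.inducedAction D₂ n N,
    AffGr.isInducedAction_inducedAction D₁ n N, AffGr.isInducedAction_inducedAction D₂ n N,
    fun R g E => AffGr.GrBar.transfer_inducedAction n h₁ h₂ g E⟩
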